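/- Let $\mathsf M_1$ be the space of degree-one rational maps $W(z)=(a_1z+a_2)/(a_3z+a_4)$, $a_1a_4-a_2a_3\neq0$, identified with $GL(2,\mathbb C)/\mathbb C^\times$. It carries the $L^2$ metric, given in real coordinates $q^i$ by $$\gamma_{ij}=\operatorname{Re}\int_{\mathbb C}\frac{dz\,d\bar z}{(1+|z|^2)^2}\,\frac{1}{(1+|W|^2)^2}\,\frac{\partial W}{\partial q^i}\,\overline{\frac{\partial W}{\partial q^j}},$$ where $dz\,d\bar z$ denotes twice Lebesgue measure. By polar decomposition every point of $\mathsf M_1$ is uniquely $[U(\sqrt{1+|\boldsymbol\lambda|^2}\,\mathbb I_2+\boldsymbol\lambda\cdot\boldsymbol\tau)]$ with $[U]\in PU(2)$, $\boldsymbol\lambda\in\mathbb R^3$ and $\boldsymbol\tau$ the Pauli matrices; we write this point $([U],\boldsymbol\lambda)$. Let $H=\{([U],\boldsymbol\lambda):\lambda_2=0\}$, let $x\in H$, let $N$ be any nonvanishing $C^1$ normal field on $H$ near $x$ (such fields exist), and put $B(u,v)=\gamma(u,\nabla_vN)$ for $u,v\in T_xH$, where $\nabla$ is the Levi-Civita connection.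 Then $\dim T_xH=5$, the form $B$ is symmetric, and the following hold. 1. If a geodesic $x(t)$, $|t|<\varepsilon$, with $x(0)=x$ and $\dot x(0)=u\in T_xH$ satisfies $x(t)\in H$ for all $t\in[0,\varepsilon)$, then $u$ lies in the null cone $C_x=\{u\in T_xH: B(u,u)=0\}$. 2. $C_x$ is a closed cone of codimension $1$ in $T_xH$: it is invariant under multiplication by every $r\ge0$ and has Hausdorff dimension $4$. 3. There is a nowhere dense (possibly empty) subset $L\subset H$, not depending on $N$, such that for every $x\in H\setminus L$ the link $C_x\cap\{u\in T_xH:\gamma(u,u)=1\}$ is homeomorphic to the suspension of the two-torus $S^1\times S^1$, and such that $x\in L$ if and only if the link is the union of two great three-spheres of the unit four-sphere of $T_xH$ (the unit spheres of two four-dimensional subspaces) meeting in a great two-sphere. At the points $x=([U],(0,0,\lambda))$, $\lambda\ge0$, one has $x\in L$ if and only if $f_2=0$, where $f_2=2B(\partial/\partial\lambda_3,\theta_1)$ is the coefficient of $d\lambda_3\,\sigma_1$ in the quadratic form $B(u,u)$; here $\theta_1$ is the left-invariant vector field on $PU(2)$ generated by $\frac i2\tau_1$. -/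

import Mathlib

open Set Filter Topology MeasureTheory Module

noncomputable section

/-! ## The one-lump moduli space and its rational maps -/

/-- The moduli space of degree one rational maps `z ↦ (a z + b) / (c z + d)`, `a d - b c ≠ 0`:
invertible matrices up to scale, with the quotient topology. -/
abbrev LumpSpace : Type :=
  GL (Fin 2) ℂ ⧸ Subgroup.center (GL (Fin 2) ℂ)

abbrev SU2 : Type := Matrix.specialUnitaryGroup (Fin 2) ℂ

abbrev R3 : Type := EuclideanSpace ℝ (Fin 3)

/-- Local coordinates `(ξ, lam)`: `ξ` parametrizes `SO(3)` and `lam` is the vector of the polar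
decomposition. -/
abbrev Coord : Type := R3 × R3

/-- `v · τ`, where `τ` is the triple of Pauli matrices. -/
def pauli (v : R3) : Matrix (Fin 2) (Fin 2) ℂ :=
  !![(v 2 : ℂ), v 0 - Complex.I * v 1; v 0 + Complex.I * v 1, -(v 2 : ℂ)]

/-- The matrix `U (1 + (i/2) ξ·τ) (√(1 + |lam|²) 1 + lam·τ)`. The middle factor is a positive
multiple of an element of `SU(2)`, so this matrix represents a point of the moduli space whose
polar decomposition has unitary part `[U (1 + (i/2) ξ·τ)]` and vector `lam`. -/
def lumpMatrix (U : SU2) (p : Coord) : Matrix (Fin 2) (Fin 2) ℂ :=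
  (U : Matrix (Fin 2) (Fin 2) ℂ) * (1 + (Complex.I / 2) • pauli p.1) *
    (((Real.sqrt (1 + ‖p.2‖ ^ 2) : ℝ) : ℂ) • (1 : Matrix (Fin 2) (Fin 2) ℂ) + pauli p.2)

theorem det_lumpMatrix (U : SU2) (p : Coord) :
    (lumpMatrix U p).det = ((1 + ‖p.1‖ ^ 2 / 4 : ℝ) : ℂ) := by
  have hU : (U : Matrix (Fin 2) (Fin 2) ℂ).det = 1 :=
    (Matrix.mem_specialUnitaryGroup_iff.1 U.2).2
  have h1 : (1 + (Complex.I / 2) • pauli p.1).det = ((1 + ‖p.1‖ ^ 2 / 4 : ℝ) : ℂ) := by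
    rw [EuclideanSpace.real_norm_sq_eq, Fin.sum_univ_three]
    simp [Matrix.det_fin_two, pauli]
    ring_nf
    simp only [Complex.I_sq, Complex.I_pow_four]
    ring
  have h2 : (((Real.sqrt (1 + ‖p.2‖ ^ 2) : ℝ) : ℂ) • (1 : Matrix (Fin 2) (Fin 2) ℂ)
      + pauli p.2).det = 1 := by
    have hs : ((Real.sqrt (1 + ‖p.2‖ ^ 2) : ℝ) : ℂ) ^ 2 =
        1 + ((p.2 0 : ℂ) ^ 2 + (p.2 1 : ℂ) ^ 2 + (p.2 2 : ℂ) ^ 2) := by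
      rw [← Complex.ofReal_pow, Real.sq_sqrt (by positivity), EuclideanSpace.real_norm_sq_eq,
        Fin.sum_univ_three]
      push_cast
      ring
    generalize ((Real.sqrt (1 + ‖p.2‖ ^ 2) : ℝ) : ℂ) = s at hs
    simp [Matrix.det_fin_two, pauli]
    ring_nf
    simp only [Complex.I_sq]
    linear_combination hs
  rw [lumpMatrix, Matrix.det_mul, Matrix.det_mul, hU, h1, h2]
  ring

theorem det_lumpMatrix_ne_zero (U : SU2) (p : Coord) : (lumpMatrix U p).det ≠ 0 := by
  rw [det_lumpMatrix]
  exact Complex.ofReal_ne_zero.2 (by positivity)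

/-- The coordinate system attached to `U`. As `U` varies these form an atlas; the point with polar
decomposition `([U], lam)` has coordinates `(0, lam)` in the coordinate system attached to `U`.
There the coordinate directions `∂/∂ξ_a` are the left invariant fields `θ_a` on `SO(3)`
generated by `(i/2) τ_a`. -/
def lump (U : SU2) (p : Coord) : LumpSpace :=
  QuotientGroup.mk (Matrix.GeneralLinearGroup.mkOfDetNeZero (lumpMatrix U p)
    (det_lumpMatrix_ne_zero U p))

/-- The rational map `W` with parameters `p`, in stereographic coordinates. -/
def lumpMap (U : SU2) (p : Coord) (z : ℂ) : ℂ :=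
  (lumpMatrix U p 0 0 * z + lumpMatrix U p 0 1) / (lumpMatrix U p 1 0 * z + lumpMatrix U p 1 1)

/-! ## The `L²` metric, its Levi-Civita connection and its geodesics -/

/-- The `L²` metric in coordinates:
`γ(u, v) = ∫ dz dz̄ (1 + |z|²)⁻² (1 + |W|²)⁻² Re (∂_u W conj (∂_v W))`,
where `dz dz̄` is twice Lebesgue measure. -/
def lumpMetric (U : SU2) (p u v : Coord) : ℝ :=
  2 * ∫ z : ℂ, 1 / (1 + ‖z‖ ^ 2) ^ 2 * (1 / (1 + ‖lumpMap U p z‖ ^ 2) ^ 2) *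
    (fderiv ℝ (fun q => lumpMap U q z) p u *
      (starRingEnd ℂ) (fderiv ℝ (fun q => lumpMap U q z) p v)).re

/-- Christoffel symbols of the first kind: `γ(∇_u v, w)` for `u, v, w` extended with constant
components. -/
def christoffel (U : SU2) (p u v w : Coord) : ℝ :=
  (1 / 2) * (fderiv ℝ (fun q => lumpMetric U q v w) p u
    + fderiv ℝ (fun q => lumpMetric U q u w) p v
    - fderiv ℝ (fun q => lumpMetric U q u v) p w)

/-- `x` is a geodesic of the `L²` metric on the open set `s` of times: in every coordinate system
it is of class `C²` and solves the geodesic equation. -/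
def IsLumpGeodesicOn (x : ℝ → LumpSpace) (s : Set ℝ) : Prop :=
  ∀ t ∈ s, ∀ U : SU2, x t ∈ range (lump U) →
    ∃ c : ℝ → Coord, ContDiffAt ℝ 2 c t ∧ (∀ᶠ r in 𝓝 t, x r = lump U (c r)) ∧
      ∀ w : Coord, lumpMetric U (c t) (deriv (deriv c) t) w
        + christoffel U (c t) (deriv c t) (deriv c t) w = 0

/-- At time `t` the curve `x` passes through the point with coordinates `p`, with velocity `u`. -/
def HasLumpVelocityAt (U : SU2) (p u : Coord) (x : ℝ → LumpSpace) (t : ℝ) : Prop :=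
  ∃ c : ℝ → Coord, c t = p ∧ HasDerivAt c u t ∧ ∀ᶠ r in 𝓝 t, x r = lump U (c r)

/-! ## The hypersurface `H`, the form `B`, its null cone and the link -/

/-- The hypersurface `H = {([U], lam) : lam₂ = 0}`. -/
def hypersurfaceH : Set LumpSpace :=
  {x | ∃ (U : SU2) (lam : R3), lam 1 = 0 ∧ x = lump U (0, lam)}

/-- The tangent space to `H`, in coordinates. -/
def tangentH : Submodule ℝ Coord where
  carrier := {w | w.2 1 = 0}
  add_mem' := by
    intro a b ha hb
    simp only [mem_ofPred_eq] at ha hb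
    simp [ha, hb]
  zero_mem' := by simp
  smul_mem' := by
    intro c a ha
    simp only [mem_ofPred_eq] at ha
    simp [ha]

/-- `N` is, near the point with coordinates `p`, a nonvanishing `C¹` normal field on `H`
(not necessarily of unit length), given by its components. -/
def IsNormalFieldAt (U : SU2) (p : Coord) (N : Coord → Coord) : Prop :=
  ContDiffAt ℝ 1 N p ∧
    ∀ᶠ q in 𝓝 p, q.2 1 = 0 → N q ≠ 0 ∧ ∀ w ∈ tangentH, lumpMetric U q (N q) w = 0

/-- `B(u, v) = γ(u, ∇_v N)`, with `∇` the Levi-Civita connection. -/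
def formB (U : SU2) (p : Coord) (N : Coord → Coord) (u v : Coord) : ℝ :=
  lumpMetric U p u (fderiv ℝ N p v) + christoffel U p v (N p) u

/-- The null cone of `B` in the tangent space to `H`. -/
def nullCone (U : SU2) (p : Coord) (N : Coord → Coord) : Set Coord :=
  {u | u ∈ tangentH ∧ formB U p N u u = 0}

/-- The link of the null cone: its intersection with the unit sphere of the tangent space to
`H`. -/
def nullLink (U : SU2) (p : Coord) (N : Coord → Coord) : Set Coord :=
  {u | u ∈ nullCone U p N ∧ lumpMetric U p u u = 1}

/-- The coefficient `f₂` of `dλ₃ σ₁` in the quadratic form `B`. -/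
def coeffF2 (U : SU2) (p : Coord) (N : Coord → Coord) : ℝ :=
  formB U p N (0, EuclideanSpace.single 2 1) (EuclideanSpace.single 0 1, 0)
    + formB U p N (EuclideanSpace.single 0 1, 0) (0, EuclideanSpace.single 2 1)

/-- The set `S` is the union of two great three-spheres in the unit four-sphere of the tangent
space to `H`, meeting in a great two-sphere: the unit spheres of two four-dimensional subspaces
whose intersection has dimension three. -/
def IsTwoThreeSpheres (U : SU2) (p : Coord) (S : Set Coord) : Prop :=
  ∃ P₁ P₂ : Submodule ℝ Coord, P₁ ≤ tangentH ∧ P₂ ≤ tangentH ∧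
    finrank ℝ P₁ = 4 ∧ finrank ℝ P₂ = 4 ∧ finrank ℝ (P₁ ⊓ P₂ : Submodule ℝ Coord) = 3 ∧
    S = {u | u ∈ P₁ ∧ lumpMetric U p u u = 1} ∪ {u | u ∈ P₂ ∧ lumpMetric U p u u = 1}

/-! ## Suspensions -/

/-- The relation that collapses each of the two ends of the cylinder `X × [0, 1]`. -/
def suspensionRel (X : Type*) (a b : X × unitInterval) : Prop :=
  (a.2 = 0 ∧ b.2 = 0) ∨ (a.2 = 1 ∧ b.2 = 1)

/-- The (unreduced) suspension of `X`, with the quotient topology. -/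
abbrev TopSuspension (X : Type*) : Type _ := Quot (suspensionRel X)

end

/-! A point of the moduli space is a matrix `M = U·C·P` up to scale, with `U` and `C` unitary up to
scale and `P = √(1+|λ|²) + λ·τ` positive. A tangent vector `u` gives `M⁻¹∂_u M = scalar + k·τ` with
`k ∈ ℂ³`. The scalar does not move the rational map, and the unitary factors on the left do not
change the integrand. So the metric at `u` is a Hermitian form `gram` in `k` that depends on `λ`
alone. It is equivariant under rotations, because SU(2) acts on the domain sphere by Möbius maps. On
the third axis, averaging over rotations of `z` and one inversion leave two positive moments,
`transverse` and `longitudinal`.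

Differentiating `γ(N, u) = 0` along `H` removes the derivatives of `N` from `B`. What is left,
`secondForm`, is symmetric and depends on `N` only through its value at the point, so an explicit
normal field may be used. Rotations about the second axis preserve `H` and carry every point of it
to the third axis, to `λ = (0, 0, r)` with `r ≥ 0`. There the normal vector is a combination of a
left invariant direction and `∂/∂λ₂`. Left invariance gives the derivative of the metric along the
first, and invariance under rotations about the first axis gives `r` times its derivative along the
second. Hence `r·B` is algebraic in the two moments. Dividing by `r`, and passing to `r = 0` by
continuity, yields `B(u,u) = f dλ₃ σ₁ + σ₃ (g dλ₁ + h σ₂)` up to a nonzero factor, with `f` a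
negative multiple of `transverse`, and with `(g, h) ≠ 0` because one linear combination of them is a
positive multiple of `longitudinal`.

Thus `B` has signature (2,2) and a one-dimensional kernel at every point of `H`. Its null cone is
linearly isomorphic to `{|a| = |b|} ⊂ ℂ × ℂ × ℝ`, a closed cone of dimension 4 whose link is the
suspension of a torus. The link is never a union of two great spheres, since a four-dimensional
subspace meets every plane on which `B` is positive. As `f₂` never vanishes either, the exceptional
set is empty.

The geodesic statement comes from pairing the geodesic equation with `N`: a curve that stays in `H`
for small nonnegative times has tangential acceleration at time zero, so only `B(u,u)` survives. -/

noncomputable section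

/-! ## Vectors -/

/-- The cross product of `ℝ³`. -/
def cross (v w : R3) : R3 :=
  !₂[v 1 * w 2 - v 2 * w 1, v 2 * w 0 - v 0 * w 2, v 0 * w 1 - v 1 * w 0]

/-- The dot product of `ℝ³`, in components. -/
def dot (v w : R3) : ℝ := v 0 * w 0 + v 1 * w 1 + v 2 * w 2

@[simp] theorem cross_zero' (v w : R3) : cross v w 0 = v 1 * w 2 - v 2 * w 1 := rfl
@[simp] theorem cross_one' (v w : R3) : cross v w 1 = v 2 * w 0 - v 0 * w 2 := rfl
@[simp] theorem cross_two' (v w : R3) : cross v w 2 = v 0 * w 1 - v 1 * w 0 := rfl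

theorem norm_sq_eq_dot (v : R3) : ‖v‖ ^ 2 = dot v v := by
  rw [EuclideanSpace.real_norm_sq_eq, Fin.sum_univ_three, dot]; ring

theorem dot_self_nonneg (v : R3) : 0 ≤ dot v v := by
  rw [← norm_sq_eq_dot]; positivity

/-- `√(1 + |v|²)`. -/
def lapse (v : R3) : ℝ := Real.sqrt (1 + ‖v‖ ^ 2)

theorem lapse_pos (v : R3) : 0 < lapse v := Real.sqrt_pos.2 (by positivity)

theorem lapse_ne_zero (v : R3) : lapse v ≠ 0 := (lapse_pos v).ne'

theorem lapse_sq (v : R3) : lapse v ^ 2 = 1 + dot v v := by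
  rw [lapse, Real.sq_sqrt (by positivity), norm_sq_eq_dot]

theorem contDiff_lapse : ContDiff ℝ 2 lapse := by
  unfold lapse
  exact (contDiff_const.add (contDiff_norm_sq ℝ)).sqrt fun x => by positivity

/-- The positive factor `√(1 + |v|²) + v · τ` of the polar decomposition. -/
def boost (v : R3) : Matrix (Fin 2) (Fin 2) ℂ := (lapse v : ℂ) • 1 + pauli v

/-- The factor `1 + (i/2) v · τ`. -/
def cayley (v : R3) : Matrix (Fin 2) (Fin 2) ℂ := 1 + (Complex.I / 2) • pauli v

theorem lumpMatrix_eq (U : SU2) (p : Coord) :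
    lumpMatrix U p = (U : Matrix (Fin 2) (Fin 2) ℂ) * cayley p.1 * boost p.2 := rfl

/-- `k · τ` for the complex vector `k = k.1 + i k.2`. -/
def pauliC (k : Coord) : Matrix (Fin 2) (Fin 2) ℂ := pauli k.1 + Complex.I • pauli k.2

/-- The left invariant form on `SO(3)`: the vector `η` at `cayley ξ` is the left invariant field
generated by `leftForm ξ η`. -/
def leftForm (ξ η : R3) : R3 := (1 + dot ξ ξ / 4)⁻¹ • (η + (1 / 2 : ℝ) • cross ξ η)

/-- Real part of the complex vector that represents a tangent vector. -/
def frameRe (v s a : R3) : R3 :=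
  lapse v • (a - cross s v) - (dot v a / lapse v) • v

/-- Imaginary part of the complex vector that represents a tangent vector. -/
def frameIm (v s a : R3) : R3 :=
  (1 / 2 + dot v v) • s - dot v s • v - cross v a

/-- The complex vector `k` such that `k · τ = M⁻¹ ∂_u M` up to a scalar matrix, for the matrix `M`
with coordinates `q`. -/
def frame (q u : Coord) : Coord :=
  (frameRe q.2 (leftForm q.1 u.1) u.2, frameIm q.2 (leftForm q.1 u.1) u.2)

/-- Derivative of `lumpMatrix U` at `q` in the direction `u`. -/
def lumpMatrixDeriv (U : SU2) (q u : Coord) : Matrix (Fin 2) (Fin 2) ℂ :=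
  (U : Matrix (Fin 2) (Fin 2) ℂ) * ((Complex.I / 2) • pauli u.1) * boost q.2
    + (U : Matrix (Fin 2) (Fin 2) ℂ) * cayley q.1 *
      (((dot q.2 u.2 / lapse q.2 : ℝ) : ℂ) • 1 + pauli u.2)

/-- The factor `cayley ξ` is `√(1+|ξ|²/4)` times an element of SU(2). The scalar term is the
logarithmic derivative of that factor, and the remaining term is the Maurer–Cartan form of the
group. -/
theorem cayley_mul (ξ η : R3) :
    (Complex.I / 2) • pauli η = cayley ξ *
      (((dot ξ η / 4 / (1 + dot ξ ξ / 4) : ℝ) : ℂ) • 1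
        + (Complex.I / 2) • pauli (leftForm ξ η)) := by
  have h0 : (1 + dot ξ ξ / 4) ≠ 0 := by have := dot_self_nonneg ξ; positivity
  have h1 : ∀ x : ℝ, (1 + dot ξ ξ / 4) * ((1 + dot ξ ξ / 4)⁻¹ * x) = x := fun x =>
    mul_inv_cancel_left₀ h0 x
  have hne : ((1 + dot ξ ξ / 4 : ℝ) : ℂ) ≠ 0 := by exact_mod_cast h0
  have key : ((1 + dot ξ ξ / 4 : ℝ) : ℂ) • ((Complex.I / 2) • pauli η) = cayley ξ *
      (((dot ξ η / 4 : ℝ) : ℂ) • 1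
        + (Complex.I / 2) • pauli (η + (1 / 2 : ℝ) • cross ξ η)) := by
    ext i j
    fin_cases i <;> fin_cases j <;>
      simp [pauli, cayley, Matrix.mul_apply, dot] <;> ring_nf <;>
      simp only [Complex.I_sq, Complex.I_pow_three, Complex.I_pow_four] <;> ring
  have h2 : ((1 + dot ξ ξ / 4 : ℝ) : ℂ) • (((dot ξ η / 4 / (1 + dot ξ ξ / 4) : ℝ) : ℂ) •
      (1 : Matrix (Fin 2) (Fin 2) ℂ) + (Complex.I / 2) • pauli (leftForm ξ η))
      = ((dot ξ η / 4 : ℝ) : ℂ) • 1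
        + (Complex.I / 2) • pauli (η + (1 / 2 : ℝ) • cross ξ η) := by
    have e1 : ((1 + dot ξ ξ / 4 : ℝ) : ℂ) * ((dot ξ η / 4 / (1 + dot ξ ξ / 4) : ℝ) : ℂ)
        = ((dot ξ η / 4 : ℝ) : ℂ) := by
      rw [← Complex.ofReal_mul, mul_div_cancel₀ _ h0]
    have e2 : ((1 + dot ξ ξ / 4 : ℝ) : ℂ) • pauli (leftForm ξ η)
        = pauli (η + (1 / 2 : ℝ) • cross ξ η) := by
      have e3 : ∀ i, (1 + dot ξ ξ / 4) * leftForm ξ η i = (η + (1 / 2 : ℝ) • cross ξ η) i :=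
        fun i => by rw [leftForm]; exact h1 _
      have e4 : ∀ i, ((1 + dot ξ ξ / 4 : ℝ) : ℂ) * leftForm ξ η i
          = (((η + (1 / 2 : ℝ) • cross ξ η) i : ℝ) : ℂ) := fun i => by
        rw [← e3]; push_cast; ring
      ext i j
      fin_cases i <;> fin_cases j <;>
        simp only [pauli, Matrix.smul_apply, Matrix.of_apply, Matrix.cons_val', smul_eq_mul,
          Fin.mk_zero, Fin.mk_one, Matrix.cons_val_zero, Matrix.cons_val_one,
          Fin.isValue, Matrix.cons_val_fin_one, mul_add, mul_sub, mul_neg,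
          mul_left_comm _ Complex.I, e4]
    rw [smul_add, smul_smul, e1, smul_comm _ (Complex.I / 2), e2]
  have h3 := smul_right_injective (Matrix (Fin 2) (Fin 2) ℂ) hne
  apply h3
  dsimp only
  rw [key, ← h2, Matrix.mul_smul]

theorem lapse_sq_complex (v : R3) :
    (lapse v : ℂ) ^ 2 = 1 + ((v 0 : ℂ) ^ 2 + (v 1 : ℂ) ^ 2 + (v 2 : ℂ) ^ 2) := by
  rw [← Complex.ofReal_pow, lapse_sq, dot]; push_cast; ring

theorem boost_eq (v : R3) : boost v = !![(lapse v : ℂ) + v 2, v 0 - Complex.I * v 1;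
    v 0 + Complex.I * v 1, lapse v - v 2] := by
  ext i j
  fin_cases i <;> fin_cases j <;> simp [boost, pauli, sub_eq_add_neg]

theorem boost_mul_inv (v : R3) : boost v * ((lapse v : ℂ) • 1 - pauli v) = 1 := by
  have hsq := lapse_sq_complex v
  ext i j
  fin_cases i <;> fin_cases j <;>
    simp [pauli, boost, Matrix.mul_apply] <;> ring_nf <;>
    simp only [Complex.I_sq, hsq] <;> ring

/-- No scalar part appears on the right, because `boost v` has determinant 1 and conjugating `s·τ`
keeps the trace zero. The inverse of the boost is `lapse v - v·τ`, since `lapse v ^ 2 - |v|² = 1`.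
-/
theorem boost_mul (v s a : R3) :
    (Complex.I / 2) • pauli s * boost v + (((dot v a / lapse v : ℝ) : ℂ) • 1 + pauli a)
      = boost v * pauliC (frameRe v s a, frameIm v s a) := by
  have hl' : (lapse v : ℂ) ≠ 0 := by exact_mod_cast lapse_ne_zero v
  have hsq := lapse_sq_complex v
  have hinv : ((lapse v : ℂ))⁻¹ * lapse v = 1 := inv_mul_cancel₀ hl'
  have key : pauliC (frameRe v s a, frameIm v s a) = ((lapse v : ℂ) • 1 - pauli v) *
      ((Complex.I / 2) • pauli s * boost v
        + (((dot v a / lapse v : ℝ) : ℂ) • 1 + pauli a)) := by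
    rw [boost_eq]
    generalize hL : lapse v = L at *
    ext i j
    fin_cases i <;> fin_cases j <;>
      simp [pauli, pauliC, frameRe, frameIm, Matrix.mul_apply, dot, hL, div_eq_mul_inv]
    · ring_nf
      simp only [Complex.I_sq, Complex.I_pow_three]
      linear_combination (-(Complex.I / 2) * (s 2:ℂ)) * hsq - ((v 0:ℂ) * a 0 + v 1 * a 1 + v 2 * a 2) * hinv
    · ring_nf
      simp only [Complex.I_sq, Complex.I_pow_three, Complex.I_pow_four]
      linear_combination (-(Complex.I / 2 * s 0 + s 1 / 2)) * hsq
    · ring_nf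
      simp only [Complex.I_sq, Complex.I_pow_three, Complex.I_pow_four]
      linear_combination (-(Complex.I / 2 * s 0 - s 1 / 2)) * hsq
    · ring_nf
      simp only [Complex.I_sq, Complex.I_pow_three]
      linear_combination (-(Complex.I / 2) * (-(s 2:ℂ))) * hsq - ((v 0:ℂ) * a 0 + v 1 * a 1 + v 2 * a 2) * hinv
  rw [key, ← mul_assoc, boost_mul_inv, one_mul]
theorem lumpMatrixDeriv_eq (U : SU2) (q u : Coord) :
    ∃ c : ℂ, lumpMatrixDeriv U q u = lumpMatrix U q * (c • 1 + pauliC (frame q u)) := by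
  refine ⟨((dot q.1 u.1 / 4 / (1 + dot q.1 q.1 / 4) : ℝ) : ℂ), ?_⟩
  rw [lumpMatrixDeriv, cayley_mul q.1 u.1, lumpMatrix_eq, mul_add _ (_ • 1) (pauliC _), frame,
    mul_assoc _ (boost q.2) (pauliC _), ← boost_mul]
  simp only [mul_add, add_mul, mul_assoc, Matrix.mul_smul, Matrix.smul_mul, mul_one]
  abel

/-! ## The Hermitian form of the `L²` metric -/

/-- The quadratic polynomial `det (ψ, (k · τ) ψ)`, where `ψ = (z, 1)`. -/
def spinor (k : Coord) (z : ℂ) : ℂ :=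
  (k.1 0 + Complex.I * k.2 0 + Complex.I * (k.1 1 + Complex.I * k.2 1)) * z ^ 2
    - 2 * (k.1 2 + Complex.I * k.2 2) * z
    - (k.1 0 + Complex.I * k.2 0 - Complex.I * (k.1 1 + Complex.I * k.2 1))

/-- `|P ψ|²`, where `P = boost v` and `ψ = (z, 1)`. -/
def boostNormSq (v : R3) (z : ℂ) : ℝ :=
  (1 + 2 * dot v v) * (1 + ‖z‖ ^ 2)
    + 2 * lapse v * (2 * v 0 * z.re - 2 * v 1 * z.im + v 2 * (‖z‖ ^ 2 - 1))

/-- The integrand of the `L²` metric. -/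
def density (v : R3) (k l : Coord) (z : ℂ) : ℝ :=
  (spinor k z * (starRingEnd ℂ) (spinor l z)).re / ((1 + ‖z‖ ^ 2) ^ 2 * boostNormSq v z ^ 2)

/-- The `L²` inner product of two complex vectors at a point with vector `v`. -/
def gram (v : R3) (k l : Coord) : ℝ := 2 * ∫ z : ℂ, density v k l z

/-- This is `det (Mψ, M(c + k·τ)ψ) = det M · det (ψ, (k·τ)ψ)` for `ψ = (z, 1)`; the scalar `c` drops
out because `det (ψ, ψ) = 0`. The left side is, up to sign, the numerator that the quotient rule
produces for `∂W`. -/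
theorem det_pauliC (M : Matrix (Fin 2) (Fin 2) ℂ) (k : Coord) (c z : ℂ) :
    (M 0 0 * z + M 0 1) * ((M * (c • 1 + pauliC k)) 1 0 * z + (M * (c • 1 + pauliC k)) 1 1)
      - (M 1 0 * z + M 1 1) * ((M * (c • 1 + pauliC k)) 0 0 * z + (M * (c • 1 + pauliC k)) 0 1)
      = M.det * spinor k z := by
  simp [Matrix.mul_apply, Matrix.det_fin_two, pauliC, pauli, spinor]
  ring

theorem norm_sq_boost (v : R3) (z : ℂ) :
    ‖boost v 0 0 * z + boost v 0 1‖ ^ 2 + ‖boost v 1 0 * z + boost v 1 1‖ ^ 2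
      = boostNormSq v z := by
  have h := lapse_sq v
  rw [boost_eq, boostNormSq]
  simp only [← Complex.normSq_eq_norm_sq]
  simp [Complex.normSq_apply]
  rw [dot] at *
  linear_combination (1 + z.re ^ 2 + z.im ^ 2) * h

theorem norm_sq_cayley (v : R3) (x y : ℂ) :
    ‖cayley v 0 0 * x + cayley v 0 1 * y‖ ^ 2 + ‖cayley v 1 0 * x + cayley v 1 1 * y‖ ^ 2
      = (1 + dot v v / 4) * (‖x‖ ^ 2 + ‖y‖ ^ 2) := by
  simp only [← Complex.normSq_eq_norm_sq]
  simp [Complex.normSq_apply, cayley, pauli, dot]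
  ring

theorem norm_sq_SU2 (U : SU2) (x y : ℂ) :
    ‖(U : Matrix (Fin 2) (Fin 2) ℂ) 0 0 * x + (U : Matrix (Fin 2) (Fin 2) ℂ) 0 1 * y‖ ^ 2
      + ‖(U : Matrix (Fin 2) (Fin 2) ℂ) 1 0 * x + (U : Matrix (Fin 2) (Fin 2) ℂ) 1 1 * y‖ ^ 2
      = ‖x‖ ^ 2 + ‖y‖ ^ 2 := by
  have h : star (U : Matrix (Fin 2) (Fin 2) ℂ) * (U : Matrix (Fin 2) (Fin 2) ℂ) = 1 :=
    Matrix.mem_unitaryGroup_iff'.1 (Matrix.mem_specialUnitaryGroup_iff.1 U.2).1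
  generalize (U : Matrix (Fin 2) (Fin 2) ℂ) = M at h ⊢
  have h00 := congrFun (congrFun h 0) 0
  have h01 := congrFun (congrFun h 0) 1
  have h11 := congrFun (congrFun h 1) 1
  have h10 := congrFun (congrFun h 1) 0
  simp [Matrix.mul_apply] at h00 h01 h11 h10
  have e : ∀ w : ℂ, ((‖w‖ ^ 2 : ℝ) : ℂ) = (starRingEnd ℂ) w * w := fun w => by
    rw [← Complex.normSq_eq_norm_sq, ← Complex.normSq_eq_conj_mul_self]
  apply Complex.ofReal_injective
  simp only [Complex.ofReal_add, e, map_add, map_mul]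
  linear_combination (starRingEnd ℂ) x * x * h00 + (starRingEnd ℂ) x * y * h01
    + (starRingEnd ℂ) y * x * h10 + (starRingEnd ℂ) y * y * h11

theorem norm_sq_lumpMatrix (U : SU2) (q : Coord) (z : ℂ) :
    ‖lumpMatrix U q 0 0 * z + lumpMatrix U q 0 1‖ ^ 2
      + ‖lumpMatrix U q 1 0 * z + lumpMatrix U q 1 1‖ ^ 2
      = (1 + dot q.1 q.1 / 4) * boostNormSq q.2 z := by
  rw [← norm_sq_boost, ← norm_sq_cayley, ← norm_sq_SU2 U
    (cayley q.1 0 0 * (boost q.2 0 0 * z + boost q.2 0 1)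
      + cayley q.1 0 1 * (boost q.2 1 0 * z + boost q.2 1 1)), lumpMatrix_eq]
  congr 3 <;> simp only [Matrix.mul_apply, Fin.sum_univ_two] <;> ring

/-- The eigenvalues of `P²` are `α ± β` with `α = 1 + 2|v|²` and `α² - β² = 1`, so the least one is
`1/(α + β) ≥ 1/(2α)`. -/
theorem boostNormSq_lower (v : R3) (z : ℂ) :
    1 + ‖z‖ ^ 2 ≤ 2 * (1 + 2 * dot v v) * boostNormSq v z := by
  set b := 2 * lapse v * (2 * v 0 * z.re - 2 * v 1 * z.im + v 2 * (‖z‖ ^ 2 - 1)) with hb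
  set N := 1 + ‖z‖ ^ 2 with hN
  have hz : ‖z‖ ^ 2 = z.re ^ 2 + z.im ^ 2 := by
    rw [← Complex.normSq_eq_norm_sq, Complex.normSq_apply]; ring
  have hdd := dot_self_nonneg v
  have hNpos : 0 < N := by positivity
  have h1 : (2 * v 0 * z.re - 2 * v 1 * z.im + v 2 * (‖z‖ ^ 2 - 1)) ^ 2 ≤ dot v v * N ^ 2 := by
    rw [hN, hz, dot]
    nlinarith [sq_nonneg (v 0 * (-2 * z.im) - v 1 * (2 * z.re)),
      sq_nonneg (v 0 * (z.re ^ 2 + z.im ^ 2 - 1) - v 2 * (2 * z.re)),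
      sq_nonneg (v 1 * (z.re ^ 2 + z.im ^ 2 - 1) - v 2 * (-2 * z.im))]
  have h2 : b ^ 2 ≤ 4 * (1 + dot v v) * (dot v v * N ^ 2) := by
    rw [hb, mul_pow, mul_pow, lapse_sq]
    nlinarith
  have h3 : boostNormSq v z = (1 + 2 * dot v v) * N + b := rfl
  rw [h3]
  have h4 : (2 * (1 + 2 * dot v v) * b) ^ 2 ≤ ((2 * (1 + 2 * dot v v) ^ 2 - 1) * N) ^ 2 := by
    nlinarith [sq_nonneg N, mul_le_mul_of_nonneg_left h2 (sq_nonneg (2 * (1 + 2 * dot v v)))]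
  have h5 := abs_le_of_sq_le_sq' h4 (by nlinarith)
  nlinarith [h5.1]

theorem boostNormSq_pos (v : R3) (z : ℂ) : 0 < boostNormSq v z := by
  have h := boostNormSq_lower v z
  have h1 := dot_self_nonneg v
  by_contra! h2
  nlinarith [sq_nonneg ‖z‖]

/-! ### Derivative of the rational map, and the metric as a Hermitian form -/

theorem differentiableAt_lapse (v : R3) : DifferentiableAt ℝ lapse v :=
  contDiff_lapse.differentiable (by norm_num) v

theorem hasDerivAt_lapse_line (v a : R3) :
    HasDerivAt (fun t : ℝ => lapse (v + t • a)) (dot v a / lapse v) 0 := by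
  have h1 : HasDerivAt (fun t : ℝ => 1 + ‖v + t • a‖ ^ 2) (2 * dot v a) 0 := by
    have : (fun t : ℝ => 1 + ‖v + t • a‖ ^ 2)
        = fun t => 1 + dot v v + 2 * dot v a * t + dot a a * t ^ 2 := by
      funext t
      rw [norm_sq_eq_dot]
      simp [dot]
      ring
    rw [this]
    have h := (((hasDerivAt_id (0 : ℝ)).const_mul (2 * dot v a)).const_add (1 + dot v v)).fun_add
      (((hasDerivAt_id (0 : ℝ)).pow 2).const_mul (dot a a))
    simpa using h
  have h2 := h1.sqrt (by positivity)
  refine h2.congr_deriv ?_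
  simp only [zero_smul, add_zero]
  rw [show Real.sqrt (1 + ‖v‖ ^ 2) = lapse v from rfl]
  have := lapse_ne_zero v
  field_simp

theorem hasDerivAt_pauli_line (v a : R3) (i j : Fin 2) :
    HasDerivAt (fun t : ℝ => pauli (v + t • a) i j) (pauli a i j) 0 := by
  have : (fun t : ℝ => pauli (v + t • a) i j) = fun t : ℝ => pauli v i j + (t : ℂ) * pauli a i j := by
    funext t
    fin_cases i <;> fin_cases j <;> simp [pauli] <;> ring
  rw [this]
  have h := ((Complex.ofRealCLM.hasDerivAt (x := (0 : ℝ))).mul_const (pauli a i j)).const_add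
    (pauli v i j)
  simpa using h

theorem hasDerivAt_lumpMatrix_line (U : SU2) (q u : Coord) (i j : Fin 2) :
    HasDerivAt (fun t : ℝ => lumpMatrix U (q + t • u) i j) (lumpMatrixDeriv U q u i j) 0 := by
  have hC : ∀ k l, HasDerivAt (fun t : ℝ => cayley (q.1 + t • u.1) k l)
      (((Complex.I / 2) • pauli u.1) k l) 0 := fun k l => by
    have := ((hasDerivAt_pauli_line q.1 u.1 k l).const_mul (Complex.I / 2)).const_add
      ((1 : Matrix (Fin 2) (Fin 2) ℂ) k l)
    simpa [cayley] using this
  have hB : ∀ k l, HasDerivAt (fun t : ℝ => boost (q.2 + t • u.2) k l)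
      ((((dot q.2 u.2 / lapse q.2 : ℝ) : ℂ) • (1 : Matrix (Fin 2) (Fin 2) ℂ) + pauli u.2) k l) 0 :=
    fun k l => by
    have := ((hasDerivAt_lapse_line q.2 u.2).ofReal_comp.mul_const
      ((1 : Matrix (Fin 2) (Fin 2) ℂ) k l)).fun_add (hasDerivAt_pauli_line q.2 u.2 k l)
    simpa [boost] using this
  have := HasDerivAt.fun_sum (u := Finset.univ) fun (k : Fin 2) _ =>
    (HasDerivAt.fun_sum (u := Finset.univ) fun (l : Fin 2) _ =>
      (hC l k).const_mul ((U : Matrix (Fin 2) (Fin 2) ℂ) i l)).mul (hB k j)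
  refine (this.congr_of_eventuallyEq (Eventually.of_forall fun t => ?_)).congr_deriv ?_
  · simp [lumpMatrix_eq, Matrix.mul_apply]
  · simp [lumpMatrixDeriv, Matrix.mul_apply]
    ring

theorem differentiableAt_lumpMatrix (U : SU2) (q : Coord) (i j : Fin 2) :
    DifferentiableAt ℝ (fun q => lumpMatrix U q i j) q := by
  have hP : ∀ (f : Coord → R3), DifferentiableAt ℝ f q → ∀ k l,
      DifferentiableAt ℝ (fun q => pauli (f q) k l) q := by
    intro f hf k l
    have h : ∀ m : Fin 3, DifferentiableAt ℝ (fun q => ((f q m : ℝ) : ℂ)) q := fun m =>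
      Complex.ofRealCLM.differentiableAt.comp q ((differentiableAt_piLp 2).1 hf m)
    have h0 := h 0
    have h1 := h 1
    have h2 := h 2
    fin_cases k <;> fin_cases l <;> simp [pauli] <;> fun_prop
  have hC : ∀ k l, DifferentiableAt ℝ (fun q : Coord => cayley q.1 k l) q := fun k l => by
    have := hP (fun q => q.1) differentiableAt_fst k l
    simp only [cayley, Matrix.add_apply, Matrix.smul_apply]
    fun_prop
  have hB : ∀ k l, DifferentiableAt ℝ (fun q : Coord => boost q.2 k l) q := fun k l => by
    have h1 := hP (fun q => q.2) differentiableAt_snd k l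
    have h2 : DifferentiableAt ℝ (fun q : Coord => ((lapse q.2 : ℝ) : ℂ)) q :=
      Complex.ofRealCLM.differentiableAt.comp q
        ((differentiableAt_lapse q.2).comp q differentiableAt_snd)
    simp only [boost, Matrix.add_apply, Matrix.smul_apply, smul_eq_mul]
    fun_prop
  simp only [lumpMatrix_eq, Matrix.mul_apply, Fin.sum_univ_two]
  have a1 := hC 0 0
  have a2 := hC 0 1
  have a3 := hC 1 0
  have a4 := hC 1 1
  have b1 := hB 0 j
  have b2 := hB 1 j
  fun_prop

theorem ae_mul_add_ne_zero {c d : ℂ} (h : c ≠ 0 ∨ d ≠ 0) : ∀ᵐ z : ℂ, c * z + d ≠ 0 := by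
  refine Set.Subsingleton.measure_zero ?_ _
  intro z hz w hw
  simp only [mem_compl_iff, mem_ofPred_eq, not_not] at hz hw
  by_cases hc : c = 0
  · simp [hc] at hz h
    exact absurd hz h
  · apply mul_left_cancel₀ hc
    linear_combination hz - hw

theorem lumpMatrix_denom_ae (U : SU2) (q : Coord) :
    ∀ᵐ z : ℂ, lumpMatrix U q 1 0 * z + lumpMatrix U q 1 1 ≠ 0 := by
  refine ae_mul_add_ne_zero ?_
  by_contra! h
  apply det_lumpMatrix_ne_zero U q
  rw [Matrix.det_fin_two, h.1, h.2]
  ring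

theorem fderiv_lumpMap (U : SU2) (q u : Coord) (z : ℂ)
    (hz : lumpMatrix U q 1 0 * z + lumpMatrix U q 1 1 ≠ 0) :
    fderiv ℝ (fun q => lumpMap U q z) q u = -((lumpMatrix U q).det * spinor (frame q u) z)
      / (lumpMatrix U q 1 0 * z + lumpMatrix U q 1 1) ^ 2 := by
  have hd := differentiableAt_lumpMatrix U q
  have d00 := hd 0 0
  have d01 := hd 0 1
  have d10 := hd 1 0
  have d11 := hd 1 1
  have hD : DifferentiableAt ℝ (fun q => lumpMap U q z) q := by
    unfold lumpMap
    simp only [div_eq_mul_inv]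
    exact ((d00.mul_const z).fun_add d01).fun_mul (((d10.mul_const z).fun_add d11).fun_inv hz)
  have hline : HasDerivAt (fun t : ℝ => q + t • u) u 0 := by
    simpa using ((hasDerivAt_id (0 : ℝ)).smul_const u).const_add q
  have h1 : HasDerivAt (fun t : ℝ => lumpMap U (q + t • u) z)
      (fderiv ℝ (fun q => lumpMap U q z) q u) 0 := by
    have hD' : HasFDerivAt (fun q => lumpMap U q z) (fderiv ℝ (fun q => lumpMap U q z) q)
        (q + (0 : ℝ) • u) := by
      simpa using hD.hasFDerivAt
    exact hD'.comp_hasDerivAt 0 hline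
  have hm := hasDerivAt_lumpMatrix_line U q u
  have h2 := (((hm 0 0).mul_const z).add (hm 0 1)).div (((hm 1 0).mul_const z).add (hm 1 1))
    (by simpa using hz)
  rw [h1.unique h2]
  simp only [zero_smul, add_zero, Pi.add_apply]
  obtain ⟨c, hc⟩ := lumpMatrixDeriv_eq U q u
  rw [hc, ← det_pauliC _ _ c]
  congr 1
  ring

/-- With `D` the denominator of `W`, one has `1 + |W|² = δ|Pψ|²/|D|²` and `∂W = -δ·spinor/D²`, so
all powers of `D` and of `δ = det M` cancel. The pole of `W` is a null set. -/
theorem lumpMetric_eq_gram (U : SU2) (q u v : Coord) :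
    lumpMetric U q u v = gram q.2 (frame q u) (frame q v) := by
  unfold lumpMetric gram
  congr 1
  apply integral_congr_ae
  filter_upwards [lumpMatrix_denom_ae U q] with z hz
  have hN := norm_sq_lumpMatrix U q z
  have hb := boostNormSq_pos q.2 z
  have hδ : 0 < 1 + dot q.1 q.1 / 4 := by have := dot_self_nonneg q.1; positivity
  rw [fderiv_lumpMap U q u z hz, fderiv_lumpMap U q v z hz, det_lumpMatrix, norm_sq_eq_dot,
    lumpMap, density]
  set δ := 1 + dot q.1 q.1 / 4
  set D := lumpMatrix U q 1 0 * z + lumpMatrix U q 1 1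
  set A := lumpMatrix U q 0 0 * z + lumpMatrix U q 0 1
  have hD : 0 < ‖D‖ := norm_pos_iff.2 hz
  have e1 : 1 + ‖A / D‖ ^ 2 = δ * boostNormSq q.2 z / ‖D‖ ^ 2 := by
    rw [norm_div, ← hN]
    field_simp
    ring
  have e2 : -((δ : ℂ) * spinor (frame q u) z) / D ^ 2 *
      (starRingEnd ℂ) (-((δ : ℂ) * spinor (frame q v) z) / D ^ 2)
      = ((δ ^ 2 / ‖D‖ ^ 4 : ℝ) : ℂ) *
        (spinor (frame q u) z * (starRingEnd ℂ) (spinor (frame q v) z)) := by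
    have e3 : ((‖D‖ : ℝ) : ℂ) ^ 2 = D * (starRingEnd ℂ) D := by
      rw [← Complex.ofReal_pow, ← Complex.normSq_eq_norm_sq, Complex.mul_conj]
    have hD' : (starRingEnd ℂ) D ≠ 0 := by simpa using hz
    push_cast
    rw [show ((‖D‖ : ℝ) : ℂ) ^ 4 = (((‖D‖ : ℝ) : ℂ) ^ 2) ^ 2 by ring, e3]
    simp only [map_div₀, map_neg, map_mul, map_pow, Complex.conj_ofReal]
    field_simp
  rw [e2, Complex.re_ofReal_mul, e1]
  field_simp

/-! ## Analysis of the Hermitian form -/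

/-- Differentiation under the integral sign. Continuity of `B` turns the pointwise bound `B x * c z`
into a dominating function that is uniform near each point. -/
theorem contDiff_one_integral {H α : Type*} [NormedAddCommGroup H] [NormedSpace ℝ H]
    [MeasurableSpace α] {μ : Measure α} {F : H → α → ℝ} {F' : H → α → H →L[ℝ] ℝ} {B : H → ℝ}
    {c : α → ℝ} (hF : ∀ x, Integrable (F x) μ) (hF' : ∀ x, AEStronglyMeasurable (F' x) μ)
    (hd : ∀ x z, HasFDerivAt (F · z) (F' x z) x) (hB : Continuous B) (hc : Integrable c μ)
    (hc0 : ∀ z, 0 ≤ c z) (hb : ∀ x z, ‖F' x z‖ ≤ B x * c z) (hcont : ∀ z, Continuous (F' · z)) :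
    ContDiff ℝ 1 (fun x => ∫ z, F x z ∂μ) := by
  have hloc : ∀ x₀, ∀ᶠ x in 𝓝 x₀, ∀ z, ‖F' x z‖ ≤ (B x₀ + 1) * c z := fun x₀ => by
    filter_upwards [hB.continuousAt.eventually_lt continuousAt_const (lt_add_one (B x₀))] with x hx z
    exact (hb x z).trans (mul_le_mul_of_nonneg_right hx.le (hc0 z))
  rw [contDiff_one_iff_hasFDerivAt]
  refine ⟨fun x => ∫ z, F' x z ∂μ, ?_, fun x₀ => ?_⟩
  · rw [continuous_iff_continuousAt]
    intro x₀
    exact continuousAt_of_dominated (Eventually.of_forall hF')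
      ((hloc x₀).mono fun x hx => Eventually.of_forall hx) (hc.const_mul _)
      (Eventually.of_forall fun z => (hcont z).continuousAt)
  · exact hasFDerivAt_integral_of_dominated_of_fderiv_le (hloc x₀)
      (Eventually.of_forall fun x => (hF x).1) (hF x₀) (hF' x₀)
      (Eventually.of_forall fun z x hx => hx z) (hc.const_mul _)
      (Eventually.of_forall fun z x _ => hd x z)

/-- The area form of the sphere, in stereographic coordinates. -/
def weight (z : ℂ) : ℝ := ((1 + ‖z‖ ^ 2) ^ 2)⁻¹

theorem weight_nonneg (z : ℂ) : 0 ≤ weight z := by unfold weight; positivity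

theorem integrable_weight : Integrable weight := by
  have h := integrable_rpow_neg_one_add_norm_sq (E := ℂ) (μ := volume) (r := 4)
    (by rw [Complex.finrank_real_complex]; norm_num)
  refine h.congr (Eventually.of_forall fun z => ?_)
  have : (0 : ℝ) ≤ 1 + ‖z‖ ^ 2 := by positivity
  beta_reduce
  rw [weight, show (-4 / 2 : ℝ) = -(2 : ℕ) by norm_num, Real.rpow_neg this, Real.rpow_natCast]

theorem continuous_spinor (k : Coord) : Continuous (spinor k) := by
  unfold spinor; fun_prop

theorem continuous_boostNormSq (v : R3) : Continuous (boostNormSq v) := by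
  unfold boostNormSq
  have := Complex.continuous_re
  have := Complex.continuous_im
  fun_prop

theorem exists_norm_spinor_le (k : Coord) :
    ∃ C : ℝ, 0 ≤ C ∧ ∀ z, ‖spinor k z‖ ≤ C * (1 + ‖z‖ ^ 2) := by
  unfold spinor
  generalize (k.1 0 + Complex.I * k.2 0 + Complex.I * (k.1 1 + Complex.I * k.2 1) : ℂ) = A
  generalize (k.1 2 + Complex.I * k.2 2 : ℂ) = B
  generalize (k.1 0 + Complex.I * k.2 0 - Complex.I * (k.1 1 + Complex.I * k.2 1) : ℂ) = D
  refine ⟨‖A‖ + ‖B‖ + ‖D‖, by positivity, fun z => ?_⟩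
  have h1 := norm_sub_le (A * z ^ 2 - 2 * B * z) D
  have h2 := norm_sub_le (A * z ^ 2) (2 * B * z)
  simp only [norm_mul, norm_pow, Complex.norm_ofNat] at h1 h2
  nlinarith [norm_nonneg A, norm_nonneg B, norm_nonneg D, sq_nonneg ‖z‖,
    mul_nonneg (norm_nonneg B) (sq_nonneg (‖z‖ - 1)), mul_nonneg (norm_nonneg A) (sq_nonneg ‖z‖),
    mul_nonneg (norm_nonneg D) (sq_nonneg ‖z‖)]

theorem exists_abs_spinor_mul_le (k l : Coord) :
    ∃ C : ℝ, 0 ≤ C ∧ ∀ z, |(spinor k z * (starRingEnd ℂ) (spinor l z)).re|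
      ≤ C * (1 + ‖z‖ ^ 2) ^ 2 := by
  obtain ⟨A, hA, hk⟩ := exists_norm_spinor_le k
  obtain ⟨B, hB, hl⟩ := exists_norm_spinor_le l
  refine ⟨A * B, mul_nonneg hA hB, fun z => ?_⟩
  refine (Complex.abs_re_le_norm _).trans ?_
  rw [norm_mul, RCLike.norm_conj]
  refine (mul_le_mul (hk z) (hl z) (norm_nonneg _) (by positivity)).trans_eq ?_
  ring

theorem continuous_density (v : R3) (k l : Coord) : Continuous (density v k l) := by
  unfold density
  refine Continuous.div ?_ ?_ fun z => ?_
  · exact Complex.continuous_re.comp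
      ((continuous_spinor k).mul (Complex.continuous_conj.comp (continuous_spinor l)))
  · have := continuous_boostNormSq v
    fun_prop
  · have := boostNormSq_pos v z
    positivity

theorem inv_boostNormSq_le (v : R3) (z : ℂ) :
    (boostNormSq v z)⁻¹ ≤ 2 * (1 + 2 * dot v v) * (1 + ‖z‖ ^ 2)⁻¹ := by
  have h := boostNormSq_lower v z
  have h1 := boostNormSq_pos v z
  have h2 : (0 : ℝ) < 1 + ‖z‖ ^ 2 := by positivity
  rw [inv_eq_one_div, div_le_iff₀ h1]
  field_simp
  linarith

theorem integrable_density (v : R3) (k l : Coord) : Integrable (density v k l) := by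
  obtain ⟨C, hC, hkl⟩ := exists_abs_spinor_mul_le k l
  refine (integrable_weight.const_mul (C * (2 * (1 + 2 * dot v v)) ^ 2)).mono'
    (continuous_density v k l).aestronglyMeasurable (Eventually.of_forall fun z => ?_)
  have h := inv_boostNormSq_le v z
  have hb := boostNormSq_pos v z
  have hN : (0 : ℝ) < 1 + ‖z‖ ^ 2 := by positivity
  have h3 : (boostNormSq v z)⁻¹ ^ 2 ≤ (2 * (1 + 2 * dot v v) * (1 + ‖z‖ ^ 2)⁻¹) ^ 2 :=
    pow_le_pow_left₀ (by positivity) h 2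
  rw [density, Real.norm_eq_abs, abs_div,
    abs_of_pos (show 0 < (1 + ‖z‖ ^ 2) ^ 2 * boostNormSq v z ^ 2 by positivity), weight]
  calc _ = |(spinor k z * (starRingEnd ℂ) (spinor l z)).re| * ((1 + ‖z‖ ^ 2) ^ 2)⁻¹
        * (boostNormSq v z)⁻¹ ^ 2 := by field_simp
    _ ≤ C * (1 + ‖z‖ ^ 2) ^ 2 * ((1 + ‖z‖ ^ 2) ^ 2)⁻¹
        * (2 * (1 + 2 * dot v v) * (1 + ‖z‖ ^ 2)⁻¹) ^ 2 := by
      gcongr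
      exact hkl z
    _ = _ := by field_simp

theorem gram_comm (v : R3) (k l : Coord) : gram v k l = gram v l k := by
  unfold gram density
  congr 2
  funext z
  congr 1
  simp only [Complex.mul_re, Complex.conj_re, Complex.conj_im]
  ring

theorem spinor_add (k k' : Coord) (z : ℂ) : spinor (k + k') z = spinor k z + spinor k' z := by
  simp [spinor]; ring

theorem spinor_smul (c : ℝ) (k : Coord) (z : ℂ) : spinor (c • k) z = c * spinor k z := by
  simp [spinor]; ring

theorem gram_add_left (v : R3) (k k' l : Coord) :
    gram v (k + k') l = gram v k l + gram v k' l := by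
  unfold gram
  rw [← mul_add, ← integral_add (integrable_density v k l) (integrable_density v k' l)]
  congr 2
  funext z
  rw [density, density, density, spinor_add, add_mul, Complex.add_re, add_div]

theorem gram_smul_left (v : R3) (c : ℝ) (k l : Coord) :
    gram v (c • k) l = c * gram v k l := by
  unfold gram
  rw [mul_left_comm, ← integral_const_mul c]
  congr 2
  funext z
  rw [density, density, spinor_smul, mul_assoc, Complex.re_ofReal_mul, mul_div_assoc]

/-- `gram` as a continuous bilinear form. -/
def gramL (v : R3) : Coord →L[ℝ] Coord →L[ℝ] ℝ :=
  (LinearMap.mk₂ ℝ (gram v) (gram_add_left v) (gram_smul_left v)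
    (fun k l l' => by rw [gram_comm, gram_add_left, gram_comm v l, gram_comm v l'])
    (fun c k l => by rw [gram_comm, gram_smul_left, gram_comm v l]; rfl)).toContinuousBilinearMap

theorem gram_self_nonneg (v : R3) (k : Coord) : 0 ≤ gram v k k := by
  refine mul_nonneg zero_le_two (integral_nonneg fun z => ?_)
  rw [density, Complex.mul_conj]
  exact div_nonneg (by simpa using Complex.normSq_nonneg _) (by positivity)

theorem eq_zero_of_spinor_eq_zero {k : Coord} (h : ∀ z, spinor k z = 0) : k = 0 := by
  have h0 := h 0
  have h1 := h 1
  have h2 := h (-1)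
  simp [spinor, Complex.ext_iff] at h0 h1 h2
  ext i
  · fin_cases i <;> simp <;> linarith
  · fin_cases i <;> simp <;> linarith

/-- A vanishing integral of a continuous nonnegative density forces `spinor k` to vanish
identically, and the coefficients of this quadratic polynomial determine `k`. -/
theorem gram_self_pos (v : R3) {k : Coord} (hk : k ≠ 0) : 0 < gram v k k := by
  refine (gram_self_nonneg v k).lt_of_ne fun h => hk (eq_zero_of_spinor_eq_zero ?_)
  have hnn : ∀ z, 0 ≤ density v k k z := fun z => by
    rw [density, Complex.mul_conj]
    exact div_nonneg (by simpa using Complex.normSq_nonneg _) (by positivity)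
  have h1 : ∫ z, density v k k z = 0 := by unfold gram at h; linarith
  rw [integral_eq_zero_iff_of_nonneg hnn (integrable_density v k k)] at h1
  have h2 := (Continuous.ae_eq_iff_eq volume (continuous_density v k k) continuous_const).1 h1
  intro z
  have h3 := congrFun h2 z
  have hb := boostNormSq_pos v z
  rw [density, Complex.mul_conj, Complex.ofReal_re] at h3
  replace h3 := div_eq_zero_iff.1 h3
  rcases h3 with h3 | h3
  · simpa using h3
  · have : 0 < (1 + ‖z‖ ^ 2) ^ 2 * boostNormSq v z ^ 2 := by positivity
    exact absurd h3 this.ne'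

theorem contDiff_coord (i : Fin 3) {n : WithTop ℕ∞} : ContDiff ℝ n (fun v : R3 => v i) :=
  contDiff_euclidean.1 contDiff_id i

theorem contDiff_dot_self {n : WithTop ℕ∞} : ContDiff ℝ n (fun v : R3 => dot v v) := by
  have := contDiff_coord 0 (n := n)
  have := contDiff_coord 1 (n := n)
  have := contDiff_coord 2 (n := n)
  unfold dot
  fun_prop

/-- `boostNormSq v z` is linear in four `C²` functions of `v`, with coefficients at most `1 + |z|²`
in size. Together with the lower bound on `boostNormSq`, the derivative of the density is dominated
by a continuous function of `v` times the area form of the sphere. -/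
theorem contDiff_gram (k l : Coord) : ContDiff ℝ 1 (fun v => gram v k l) := by
  have h0 := contDiff_coord 0 (n := 2)
  have h1 := contDiff_coord 1 (n := 2)
  have h2 := contDiff_coord 2 (n := 2)
  have hl := contDiff_lapse
  set a : R3 → ℝ := fun v => 1 + 2 * dot v v
  set b : Fin 3 → R3 → ℝ := fun i v => 2 * lapse v * v i
  have ha : ContDiff ℝ 2 a := by
    have := contDiff_dot_self (n := 2)
    fun_prop
  have hb : ∀ i, ContDiff ℝ 2 (b i) := fun i => by
    have := contDiff_coord i (n := 2)
    fun_prop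
  have hbn : ∀ v z, boostNormSq v z = (1 + ‖z‖ ^ 2) * a v + 2 * z.re * b 0 v - 2 * z.im * b 1 v
      + (‖z‖ ^ 2 - 1) * b 2 v := fun v z => by
    simp only [boostNormSq, a, b]; ring
  have hda : ∀ v, HasFDerivAt a (fderiv ℝ a v) v := fun v =>
    (ha.differentiable (by norm_num) v).hasFDerivAt
  have hdb : ∀ i v, HasFDerivAt (b i) (fderiv ℝ (b i) v) v := fun i v =>
    ((hb i).differentiable (by norm_num) v).hasFDerivAt
  have hca : Continuous (fderiv ℝ a) := ha.continuous_fderiv (by norm_num)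
  have hcb : ∀ i, Continuous (fderiv ℝ (b i)) := fun i => (hb i).continuous_fderiv (by norm_num)
  set D : R3 → ℂ → R3 →L[ℝ] ℝ := fun v z => (1 + ‖z‖ ^ 2) • fderiv ℝ a v
    + (2 * z.re) • fderiv ℝ (b 0) v - (2 * z.im) • fderiv ℝ (b 1) v
    + (‖z‖ ^ 2 - 1) • fderiv ℝ (b 2) v
  have hD : ∀ v z, HasFDerivAt (fun v => boostNormSq v z) (D v z) v := fun v z => by
    simp only [hbn]
    exact ((((hda v).const_mul _).add ((hdb 0 v).const_mul _)).sub ((hdb 1 v).const_mul _)).add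
      ((hdb 2 v).const_mul _)
  set M : R3 → ℝ := fun v => ‖fderiv ℝ a v‖ + ‖fderiv ℝ (b 0) v‖ + ‖fderiv ℝ (b 1) v‖
    + ‖fderiv ℝ (b 2) v‖
  have hM : Continuous M := by
    have := hcb 0; have := hcb 1; have := hcb 2
    fun_prop
  have hDM : ∀ v z, ‖D v z‖ ≤ (1 + ‖z‖ ^ 2) * M v := fun v z => by
    have hz : ‖z‖ ^ 2 = z.re ^ 2 + z.im ^ 2 := by
      rw [← Complex.normSq_eq_norm_sq, Complex.normSq_apply]; ring
    have hr : |2 * z.re| ≤ 1 + ‖z‖ ^ 2 := abs_le.2 ⟨by nlinarith [sq_nonneg (z.re + 1), sq_nonneg z.im],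
      by nlinarith [sq_nonneg (z.re - 1), sq_nonneg z.im]⟩
    have hi : |2 * z.im| ≤ 1 + ‖z‖ ^ 2 := abs_le.2 ⟨by nlinarith [sq_nonneg (z.im + 1), sq_nonneg z.re],
      by nlinarith [sq_nonneg (z.im - 1), sq_nonneg z.re]⟩
    have h3 : |‖z‖ ^ 2 - 1| ≤ 1 + ‖z‖ ^ 2 := abs_le.2 ⟨by nlinarith [sq_nonneg ‖z‖], by linarith⟩
    have h4 : |1 + ‖z‖ ^ 2| ≤ 1 + ‖z‖ ^ 2 := (abs_of_pos (by positivity)).le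
    calc ‖D v z‖ ≤ |1 + ‖z‖ ^ 2| * ‖fderiv ℝ a v‖ + |2 * z.re| * ‖fderiv ℝ (b 0) v‖
          + |2 * z.im| * ‖fderiv ℝ (b 1) v‖ + |‖z‖ ^ 2 - 1| * ‖fderiv ℝ (b 2) v‖ := by
          simp only [← Real.norm_eq_abs, ← norm_smul]
          exact (norm_add_le _ _).trans (add_le_add_left ((norm_sub_le _ _).trans
            (add_le_add_left (norm_add_le _ _) _)) _)
      _ ≤ (1 + ‖z‖ ^ 2) * ‖fderiv ℝ a v‖ + (1 + ‖z‖ ^ 2) * ‖fderiv ℝ (b 0) v‖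
          + (1 + ‖z‖ ^ 2) * ‖fderiv ℝ (b 1) v‖ + (1 + ‖z‖ ^ 2) * ‖fderiv ℝ (b 2) v‖ := by
          gcongr
      _ = _ := by ring
  obtain ⟨C, hC, hkl⟩ := exists_abs_spinor_mul_le k l
  set num : ℂ → ℝ := fun z => (spinor k z * (starRingEnd ℂ) (spinor l z)).re * weight z
  have hnumc : Continuous num := by
    refine Continuous.mul (Complex.continuous_re.comp ((continuous_spinor k).mul
      (Complex.continuous_conj.comp (continuous_spinor l)))) ?_
    unfold weight
    exact Continuous.inv₀ (by fun_prop) fun z => by positivity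
  have hnum : ∀ z, |num z| ≤ C := fun z => by
    have hN : (0 : ℝ) < 1 + ‖z‖ ^ 2 := by positivity
    rw [abs_mul, abs_of_nonneg (weight_nonneg z), weight, ← div_eq_mul_inv,
      div_le_iff₀ (by positivity)]
    exact hkl z
  have hden : ∀ v z, density v k l z = num z * (boostNormSq v z ^ 2)⁻¹ := fun v z => by
    simp only [density, num, weight, div_eq_mul_inv, mul_inv]; ring
  unfold gram
  refine contDiff_const.mul (contDiff_one_integral
    (F' := fun v z => (num z * (-2 * (boostNormSq v z)⁻¹ ^ 3)) • D v z)
    (B := fun v => C * 2 * (2 * (1 + 2 * dot v v)) ^ 3 * M v) (c := weight)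
    (fun v => integrable_density v k l) (fun v => ?_) (fun v z => ?_) ?_ integrable_weight
    weight_nonneg (fun v z => ?_) fun z => ?_)
  · refine Continuous.aestronglyMeasurable ?_
    have hc : Continuous fun z => (boostNormSq v z)⁻¹ :=
      (continuous_boostNormSq v).inv₀ fun z => (boostNormSq_pos v z).ne'
    have := Complex.continuous_re
    have := Complex.continuous_im
    simp only [D]
    fun_prop
  · simp only [hden]
    have hne := (boostNormSq_pos v z).ne'
    have := (((hasDerivAt_pow 2 (boostNormSq v z)).fun_inv (pow_ne_zero 2 hne))).comp_hasFDerivAt v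
      (hD v z)
    refine (this.const_mul (num z)).congr_fderiv ?_
    rw [smul_smul]
    congr 1
    push_cast
    field_simp
  · have := (contDiff_dot_self (n := 1)).continuous
    fun_prop
  · have h := inv_boostNormSq_le v z
    have hbp := boostNormSq_pos v z
    have hN : (0 : ℝ) < 1 + ‖z‖ ^ 2 := by positivity
    have hdd := dot_self_nonneg v
    rw [norm_smul, Real.norm_eq_abs, abs_mul (num z), abs_mul (-2),
      abs_of_pos (show 0 < (boostNormSq v z)⁻¹ ^ 3 by positivity)]
    have h3 : (boostNormSq v z)⁻¹ ^ 3 ≤ (2 * (1 + 2 * dot v v) * (1 + ‖z‖ ^ 2)⁻¹) ^ 3 :=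
      pow_le_pow_left₀ (by positivity) h 3
    calc _ ≤ C * (|(-2 : ℝ)| * (2 * (1 + 2 * dot v v) * (1 + ‖z‖ ^ 2)⁻¹) ^ 3)
          * ((1 + ‖z‖ ^ 2) * M v) := by
          gcongr
          · exact hnum z
          · exact hDM v z
      _ = _ := by
          rw [weight, abs_neg, abs_two]
          field_simp
  · have hbc : Continuous fun v => boostNormSq v z :=
      continuous_iff_continuousAt.2 fun v => (hD v z).continuousAt
    have hc : Continuous fun v => (boostNormSq v z)⁻¹ :=
      hbc.inv₀ fun v => (boostNormSq_pos v z).ne'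
    have := hcb 0; have := hcb 1; have := hcb 2
    simp only [D]
    fun_prop

theorem contDiff_gramL : ContDiff ℝ 1 gramL :=
  contDiff_clm_apply_iff.2 fun k => contDiff_clm_apply_iff.2 fun l => contDiff_gram k l

/-! ## Möbius transformations and rotations -/

/-- Change of variables: away from its pole the Möbius map is injective and holomorphic, with real
Jacobian `|g'|²`, and its image misses at most one point. -/
theorem integral_moebius {a b c d : ℂ} (h : a * d - b * c ≠ 0) (f : ℂ → ℝ) :
    ∫ z, ‖a * d - b * c‖ ^ 2 / ‖c * z + d‖ ^ 4 * f ((a * z + b) / (c * z + d)) = ∫ z, f z := by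
  set s : Set ℂ := {z | c * z + d ≠ 0}
  set g : ℂ → ℂ := fun z => (a * z + b) / (c * z + d)
  have hs : ∀ᵐ z, z ∈ s := ae_mul_add_ne_zero (by
    by_contra! hcd
    rw [hcd.1, hcd.2] at h
    simp at h)
  have hden : ∀ z ∈ s, -c * g z + a = (a * d - b * c) / (c * z + d) := fun z hz => by
    have : c * z + d ≠ 0 := hz
    simp only [g]
    field_simp
    ring
  have hsm : MeasurableSet s := by
    have : IsOpen s := isOpen_ne_fun (by fun_prop) (by fun_prop)
    exact this.measurableSet
  have him : ∀ᵐ w, w ∈ g '' s := by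
    have : ∀ᵐ w : ℂ, -c * w + a ≠ 0 := ae_mul_add_ne_zero (by
      by_contra! hcd
      rw [neg_eq_zero.1 hcd.1, hcd.2] at h
      simp at h)
    filter_upwards [this] with w hw
    have e : c * ((d * w - b) / (-c * w + a)) + d = (a * d - b * c) / (-c * w + a) := by
      rw [eq_div_iff hw, add_mul, mul_div_assoc', div_mul_cancel₀ _ hw]
      ring
    have hz : c * ((d * w - b) / (-c * w + a)) + d ≠ 0 := by
      rw [e]; exact div_ne_zero h hw
    refine ⟨(d * w - b) / (-c * w + a), hz, ?_⟩
    simp only [g]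
    rw [e, div_div_eq_mul_div, div_eq_iff h, add_mul, mul_div_assoc', div_mul_cancel₀ _ hw]
    ring
  have hder : ∀ z ∈ s, HasDerivAt g ((a * d - b * c) / (c * z + d) ^ 2) z := fun z hz => by
    have h1 := (((hasDerivAt_id z).const_mul a).add_const b).fun_div
      (((hasDerivAt_id z).const_mul c).add_const d) hz
    refine h1.congr_deriv ?_
    simp only [id_eq, mul_one]
    ring
  have hinj : InjOn g s := fun z hz w hw hzw => by
    have h1 := hden z hz
    rw [hzw, hden w hw] at h1
    have hz' : c * z + d ≠ 0 := hz
    have hw' : c * w + d ≠ 0 := hw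
    have h2 : c * z + d = c * w + d := by
      rw [div_eq_div_iff hw' hz'] at h1
      exact mul_left_cancel₀ h h1
    have h3 : a * z + b = a * w + b := by
      simp only [g] at hzw
      rwa [h2, div_left_inj' hw'] at hzw
    apply mul_left_cancel₀ h
    linear_combination d * h3 - b * h2
  have key := integral_image_eq_integral_abs_det_fderiv_smul (volume : Measure ℂ) hsm
    (fun z hz => ((hder z hz).hasFDerivAt.restrictScalars ℝ).hasFDerivWithinAt) hinj f
  rw [setIntegral_eq_integral_of_ae_compl_eq_zero
      (him.mono fun z hz hz' => absurd hz hz'),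
    setIntegral_eq_integral_of_ae_compl_eq_zero (hs.mono fun z hz hz' => absurd hz hz')] at key
  rw [key]
  congr 1
  funext z
  rw [smul_eq_mul]
  congr 1
  -- The real determinant of multiplication by `w` is the field norm of `ℂ` over `ℝ`.
  have hdet : ∀ w : ℂ, ((ContinuousLinearMap.toSpanSingleton ℂ w).restrictScalars ℝ).det
      = ‖w‖ ^ 2 := fun w => by
    rw [← Complex.normSq_eq_norm_sq, ← Algebra.norm_complex_apply, Algebra.norm_apply,
      ContinuousLinearMap.det]
    congr 1
    ext
    simp [mul_comm]
  rw [hdet, norm_div, norm_pow, abs_of_nonneg (by positivity)]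
  ring

/-- The weights in `|cz + d|` balance: the Jacobian and the two spinors contribute exponent `-4`
each, and the two squared factors of the denominator contribute `+4` each. -/
theorem gram_eq_of_moebius {v v' : R3} {k k' l l' : Coord} {a b c d : ℂ}
    (h : a * d - b * c = 1)
    (hk : ∀ z, c * z + d ≠ 0 →
      spinor k ((a * z + b) / (c * z + d)) = spinor k' z / (c * z + d) ^ 2)
    (hl : ∀ z, c * z + d ≠ 0 →
      spinor l ((a * z + b) / (c * z + d)) = spinor l' z / (c * z + d) ^ 2)
    (hn : ∀ z, ‖a * z + b‖ ^ 2 + ‖c * z + d‖ ^ 2 = 1 + ‖z‖ ^ 2)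
    (hv : ∀ z, c * z + d ≠ 0 →
      boostNormSq v ((a * z + b) / (c * z + d)) = boostNormSq v' z / ‖c * z + d‖ ^ 2) :
    gram v k l = gram v' k' l' := by
  unfold gram
  rw [← integral_moebius (a := a) (b := b) (c := c) (d := d) (by rw [h]; exact one_ne_zero)]
  congr 1
  have hs : ∀ᵐ z : ℂ, c * z + d ≠ 0 := ae_mul_add_ne_zero (by
    by_contra! hcd
    rw [hcd.1, hcd.2] at h
    simp at h)
  apply integral_congr_ae
  filter_upwards [hs] with z hz
  have hz' : 0 < ‖c * z + d‖ := norm_pos_iff.2 hz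
  have hb := boostNormSq_pos v' z
  have e1 : 1 + ‖(a * z + b) / (c * z + d)‖ ^ 2 = (1 + ‖z‖ ^ 2) / ‖c * z + d‖ ^ 2 := by
    rw [← hn z, norm_div, div_pow, add_div, div_self (by positivity), add_comm]
  have e2 : spinor k' z / (c * z + d) ^ 2 * (starRingEnd ℂ) (spinor l' z / (c * z + d) ^ 2)
      = ((1 / ‖c * z + d‖ ^ 4 : ℝ) : ℂ) * (spinor k' z * (starRingEnd ℂ) (spinor l' z)) := by
    have e3 : ((‖c * z + d‖ : ℝ) : ℂ) ^ 2 = (c * z + d) * (starRingEnd ℂ) (c * z + d) := by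
      rw [← Complex.ofReal_pow, ← Complex.normSq_eq_norm_sq, Complex.mul_conj]
    have hD' : (starRingEnd ℂ) (c * z + d) ≠ 0 := (map_ne_zero _).2 hz
    rw [Complex.ofReal_div, Complex.ofReal_pow, show ((‖c * z + d‖ : ℝ) : ℂ) ^ 4
      = (((‖c * z + d‖ : ℝ) : ℂ) ^ 2) ^ 2 by ring, e3, map_div₀, map_pow, Complex.ofReal_one]
    generalize (starRingEnd ℂ) (c * z + d) = w at *
    field_simp
  rw [density, density, hk z hz, hl z hz, hv z hz, e1, e2, Complex.re_ofReal_mul, h, norm_one]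
  field_simp

/-- Rotation about the first axis. -/
def rotX (θ : ℝ) : R3 →ₗ[ℝ] R3 where
  toFun v := !₂[v 0, Real.cos θ * v 1 - Real.sin θ * v 2, Real.sin θ * v 1 + Real.cos θ * v 2]
  map_add' v w := by ext i; fin_cases i <;> simp <;> ring
  map_smul' c v := by ext i; fin_cases i <;> simp <;> ring

/-- Rotation about the second axis. -/
def rotY (θ : ℝ) : R3 →ₗ[ℝ] R3 where
  toFun v := !₂[Real.cos θ * v 0 + Real.sin θ * v 2, v 1, -Real.sin θ * v 0 + Real.cos θ * v 2]
  map_add' v w := by ext i; fin_cases i <;> simp <;> ring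
  map_smul' c v := by ext i; fin_cases i <;> simp <;> ring

@[simp] theorem rotX_zero (θ : ℝ) (v : R3) : rotX θ v 0 = v 0 := rfl
@[simp] theorem rotX_one (θ : ℝ) (v : R3) :
    rotX θ v 1 = Real.cos θ * v 1 - Real.sin θ * v 2 := rfl
@[simp] theorem rotX_two (θ : ℝ) (v : R3) :
    rotX θ v 2 = Real.sin θ * v 1 + Real.cos θ * v 2 := rfl
@[simp] theorem rotY_zero (θ : ℝ) (v : R3) :
    rotY θ v 0 = Real.cos θ * v 0 + Real.sin θ * v 2 := rfl
@[simp] theorem rotY_one (θ : ℝ) (v : R3) : rotY θ v 1 = v 1 := rfl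
@[simp] theorem rotY_two (θ : ℝ) (v : R3) :
    rotY θ v 2 = -Real.sin θ * v 0 + Real.cos θ * v 2 := rfl

/-- The linear maps of `ℝ³` that preserve the dot and cross products. -/
def IsRotation (R : R3 →ₗ[ℝ] R3) : Prop :=
  (∀ v w, dot (R v) (R w) = dot v w) ∧ ∀ v w, cross (R v) (R w) = R (cross v w)

theorem isRotation_rotX (θ : ℝ) : IsRotation (rotX θ) := by
  have h := Real.sin_sq_add_cos_sq θ
  refine ⟨fun v w => ?_, fun v w => ?_⟩
  · simp only [dot, rotX_zero, rotX_one, rotX_two]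
    linear_combination (v 1 * w 1 + v 2 * w 2) * h
  · ext i
    fin_cases i <;> simp
    · linear_combination (v 1 * w 2 - v 2 * w 1) * h
    · ring
    · ring

theorem isRotation_rotY (θ : ℝ) : IsRotation (rotY θ) := by
  have h := Real.sin_sq_add_cos_sq θ
  refine ⟨fun v w => ?_, fun v w => ?_⟩
  · simp only [dot, rotY_zero, rotY_one, rotY_two]
    linear_combination (v 0 * w 0 + v 2 * w 2) * h
  · ext i
    fin_cases i <;> simp
    · ring
    · linear_combination (v 2 * w 0 - v 0 * w 2) * h
    · ring

theorem lapse_rotation {R : R3 →ₗ[ℝ] R3} (hR : IsRotation R) (v : R3) :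
    lapse (R v) = lapse v := by
  rw [lapse, lapse, norm_sq_eq_dot, norm_sq_eq_dot, hR.1]

theorem leftForm_rotation {R : R3 →ₗ[ℝ] R3} (hR : IsRotation R) (ξ η : R3) :
    leftForm (R ξ) (R η) = R (leftForm ξ η) := by
  rw [leftForm, leftForm, hR.1, hR.2, map_smul, map_add, map_smul]

/-- Every ingredient of `frame` is built from dot and cross products. -/
theorem frame_rotation {R : R3 →ₗ[ℝ] R3} (hR : IsRotation R) (q u : Coord) :
    frame (R.prodMap R q) (R.prodMap R u) = R.prodMap R (frame q u) := by
  simp only [frame, LinearMap.prodMap_apply, leftForm_rotation hR, frameRe, frameIm,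
    lapse_rotation hR, hR.1, hR.2, map_sub, map_smul]

theorem half_angle (θ : ℝ) : ∃ c s : ℝ, c ^ 2 + s ^ 2 = 1 ∧ Real.cos θ = c ^ 2 - s ^ 2 ∧
    Real.sin θ = 2 * s * c := by
  refine ⟨Real.cos (θ / 2), Real.sin (θ / 2), Real.cos_sq_add_sin_sq _, ?_, ?_⟩
  · rw [← Real.cos_two_mul']; ring_nf
  · rw [← Real.sin_two_mul]; ring_nf

theorem norm_sq_eq_re_im (z : ℂ) : ‖z‖ ^ 2 = z.re ^ 2 + z.im ^ 2 := by
  rw [← Complex.normSq_eq_norm_sq, Complex.normSq_apply]; ring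

/-- `|P ψ|²` on homogeneous coordinates. -/
theorem boostNormSq_div (v : R3) (x y : ℂ) (hy : y ≠ 0) :
    boostNormSq v (x / y) = ((1 + 2 * dot v v) * (‖x‖ ^ 2 + ‖y‖ ^ 2)
      + 2 * lapse v * (2 * v 0 * (x * (starRingEnd ℂ) y).re
        - 2 * v 1 * (x * (starRingEnd ℂ) y).im + v 2 * (‖x‖ ^ 2 - ‖y‖ ^ 2))) / ‖y‖ ^ 2 := by
  have hy' : 0 < ‖y‖ := norm_pos_iff.2 hy
  have e : x / y = ((1 / ‖y‖ ^ 2 : ℝ) : ℂ) * (x * (starRingEnd ℂ) y) := by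
    have hD' : (starRingEnd ℂ) y ≠ 0 := (map_ne_zero _).2 hy
    rw [Complex.ofReal_div, ← Complex.normSq_eq_norm_sq, ← Complex.mul_conj, Complex.ofReal_one]
    field_simp
  have e2 : (x / y).re = (x * (starRingEnd ℂ) y).re / ‖y‖ ^ 2 := by
    rw [e, Complex.re_ofReal_mul]; ring
  have e3 : (x / y).im = (x * (starRingEnd ℂ) y).im / ‖y‖ ^ 2 := by
    rw [e, Complex.im_ofReal_mul]; ring
  rw [boostNormSq, e2, e3, norm_div]
  field_simp
  ring

theorem spinor_div (k : Coord) (x y : ℂ) (hy : y ≠ 0) :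
    spinor k (x / y) = ((k.1 0 + Complex.I * k.2 0 + Complex.I * (k.1 1 + Complex.I * k.2 1)) * x ^ 2
    - 2 * (k.1 2 + Complex.I * k.2 2) * (x * y)
    - (k.1 0 + Complex.I * k.2 0 - Complex.I * (k.1 1 + Complex.I * k.2 1)) * y ^ 2) / y ^ 2 := by
  rw [spinor]
  field_simp

/-- The rotation is induced by conjugating Pauli matrices with an element of SU(2), whose entries
involve the half angle; that element acts on `z` as a Möbius isometry of the sphere. -/
theorem gram_rotY (θ : ℝ) (v : R3) (k l : Coord) :
    gram (rotY θ v) ((rotY θ).prodMap (rotY θ) k) ((rotY θ).prodMap (rotY θ) l)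
      = gram v k l := by
  obtain ⟨c, s, hcs, hc, hs⟩ := half_angle θ
  have hcs' : (c : ℂ) ^ 2 + (s : ℂ) ^ 2 = 1 := by exact_mod_cast hcs
  have hk : ∀ (k : Coord) (z : ℂ), -(s : ℂ) * z + c ≠ 0 →
      spinor k (((c : ℂ) * z + s) / (-(s : ℂ) * z + c))
        = spinor ((rotY θ).prodMap (rotY θ) k) z / (-(s : ℂ) * z + c) ^ 2 := fun k z hz => by
    rw [spinor_div _ _ _ hz, spinor]
    congr 1
    simp only [LinearMap.prodMap_apply, rotY_zero, rotY_one, rotY_two, hc, hs]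
    push_cast
    linear_combination (Complex.I * (k.1 1 + Complex.I * k.2 1)) * (z ^ 2 + 1) * hcs'
  have hn : ∀ z : ℂ, ‖(c : ℂ) * z + s‖ ^ 2 + ‖-(s : ℂ) * z + c‖ ^ 2 = 1 + ‖z‖ ^ 2 := fun z => by
    simp only [norm_sq_eq_re_im]
    simp
    linear_combination (1 + z.re ^ 2 + z.im ^ 2) * hcs
  refine (gram_eq_of_moebius (a := c) (b := s) (c := -s) (d := c) ?_ (hk k) (hk l) hn
    fun z hz => ?_).symm
  · linear_combination hcs'
  · rw [boostNormSq_div _ _ _ hz, hn, boostNormSq, (isRotation_rotY θ).1,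
      lapse_rotation (isRotation_rotY θ)]
    congr 1
    simp only [norm_sq_eq_re_im, rotY_zero, rotY_one, rotY_two, hc, hs]
    simp
    left
    linear_combination (-2 * v 1 * z.im) * hcs

theorem gram_rotX (θ : ℝ) (v : R3) (k l : Coord) :
    gram (rotX θ v) ((rotX θ).prodMap (rotX θ) k) ((rotX θ).prodMap (rotX θ) l)
      = gram v k l := by
  obtain ⟨c, s, hcs, hc, hs⟩ := half_angle θ
  have hcs' : (c : ℂ) ^ 2 + (s : ℂ) ^ 2 = 1 := by exact_mod_cast hcs
  have hk : ∀ (k : Coord) (z : ℂ), Complex.I * s * z + c ≠ 0 →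
      spinor k (((c : ℂ) * z + Complex.I * s) / (Complex.I * s * z + c))
        = spinor ((rotX θ).prodMap (rotX θ) k) z / (Complex.I * s * z + c) ^ 2 := fun k z hz => by
    rw [spinor_div _ _ _ hz, spinor]
    congr 1
    simp only [LinearMap.prodMap_apply, rotX_zero, rotX_one, rotX_two, hc, hs]
    push_cast
    linear_combination (k.1 0 + Complex.I * k.2 0) * (z ^ 2 - 1) * hcs'
      + (-(k.1 0 + Complex.I * k.2 0) * (z ^ 2 - 1) * s ^ 2
        + (k.1 1 + Complex.I * k.2 1) * (Complex.I * s ^ 2 * (z ^ 2 + 1) + 4 * c * s * z)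
        - 2 * (k.1 2 + Complex.I * k.2 2) * s ^ 2 * z) * Complex.I_sq
  have hn : ∀ z : ℂ, ‖(c : ℂ) * z + Complex.I * s‖ ^ 2 + ‖Complex.I * s * z + c‖ ^ 2
      = 1 + ‖z‖ ^ 2 := fun z => by
    simp only [norm_sq_eq_re_im]
    simp
    linear_combination (1 + z.re ^ 2 + z.im ^ 2) * hcs
  refine (gram_eq_of_moebius (a := c) (b := Complex.I * s) (c := Complex.I * s) (d := c) ?_
    (hk k) (hk l) hn fun z hz => ?_).symm
  · linear_combination hcs' - (s : ℂ) ^ 2 * Complex.I_sq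
  · rw [boostNormSq_div _ _ _ hz, hn, boostNormSq, (isRotation_rotX θ).1,
      lapse_rotation (isRotation_rotX θ)]
    congr 1
    simp only [norm_sq_eq_re_im, rotX_zero, rotX_one, rotX_two, hc, hs]
    simp
    left
    linear_combination (2 * v 0 * z.re) * hcs

/-! ### The Hermitian form on the third axis -/

theorem average_quadratic (A B D A' B' D' z : ℂ) :
    ((A * z ^ 2 - 2 * B * z - D)
        * (starRingEnd ℂ) (A' * z ^ 2 - 2 * B' * z - D')).re
      + ((A * (Complex.I * z) ^ 2 - 2 * B * (Complex.I * z) - D)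
        * (starRingEnd ℂ) (A' * (Complex.I * z) ^ 2 - 2 * B' * (Complex.I * z) - D')).re
      + ((A * (-1 * z) ^ 2 - 2 * B * (-1 * z) - D)
        * (starRingEnd ℂ) (A' * (-1 * z) ^ 2 - 2 * B' * (-1 * z) - D')).re
      + ((A * (-Complex.I * z) ^ 2 - 2 * B * (-Complex.I * z) - D)
        * (starRingEnd ℂ) (A' * (-Complex.I * z) ^ 2 - 2 * B' * (-Complex.I * z) - D')).re
      = 4 * ((A * (starRingEnd ℂ) A').re * ‖z‖ ^ 4 + 4 * (B * (starRingEnd ℂ) B').re * ‖z‖ ^ 2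
        + (D * (starRingEnd ℂ) D').re) := by
  have e : ((‖z‖ ^ 2 : ℝ) : ℂ) = z * (starRingEnd ℂ) z := by
    rw [← Complex.normSq_eq_norm_sq, Complex.mul_conj]
  have key : (A * z ^ 2 - 2 * B * z - D)
        * (starRingEnd ℂ) (A' * z ^ 2 - 2 * B' * z - D')
      + (A * (Complex.I * z) ^ 2 - 2 * B * (Complex.I * z) - D)
        * (starRingEnd ℂ) (A' * (Complex.I * z) ^ 2 - 2 * B' * (Complex.I * z) - D')
      + (A * (-1 * z) ^ 2 - 2 * B * (-1 * z) - D)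
        * (starRingEnd ℂ) (A' * (-1 * z) ^ 2 - 2 * B' * (-1 * z) - D')
      + (A * (-Complex.I * z) ^ 2 - 2 * B * (-Complex.I * z) - D)
        * (starRingEnd ℂ) (A' * (-Complex.I * z) ^ 2 - 2 * B' * (-Complex.I * z) - D')
      = ((4 * ‖z‖ ^ 4 : ℝ) : ℂ) * (A * (starRingEnd ℂ) A')
        + ((16 * ‖z‖ ^ 2 : ℝ) : ℂ) * (B * (starRingEnd ℂ) B')
        + ((4 : ℝ) : ℂ) * (D * (starRingEnd ℂ) D') := by
    rw [Complex.ofReal_mul, Complex.ofReal_mul, show ‖z‖ ^ 4 = (‖z‖ ^ 2) ^ 2 by ring,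
      Complex.ofReal_pow (‖z‖ ^ 2), e]
    simp only [map_sub, map_mul, map_pow, map_neg, map_one, map_ofNat, Complex.conj_I, mul_pow,
      neg_sq, Complex.I_sq, one_pow]
    push_cast
    generalize (starRingEnd ℂ) z = w
    linear_combination (-8 * B * (starRingEnd ℂ) B' * z * w) * Complex.I_sq
  have := congrArg Complex.re key
  simp only [Complex.add_re, Complex.re_ofReal_mul] at this
  linear_combination this

theorem integral_linear_combination {f g h : ℂ → ℝ} (hf : Integrable f) (hg : Integrable g)
    (hh : Integrable h) (a b c : ℝ) :
    ∫ z, (a * f z + b * g z + c * h z) = a * (∫ z, f z) + b * (∫ z, g z) + c * ∫ z, h z := by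
  have h1 : Integrable fun z => a * f z + b * g z := (hf.const_mul a).add (hg.const_mul b)
  rw [integral_add h1 (hh.const_mul c), integral_add (hf.const_mul a) (hg.const_mul b),
    integral_const_mul, integral_const_mul, integral_const_mul]

/-- On the axis the denominator depends only on `|z|`, so the density may be averaged over `z ↦ iz`.
The cross terms of the two quadratics have angular frequency ±1 or ±2, and the fourth roots of unity
cancel them. -/
theorem gram_eq_average (v : R3) (h0 : v 0 = 0) (h1 : v 1 = 0) (k l : Coord) :
    gram v k l = 2 * ∫ z : ℂ,
      ((k.1 0 - k.2 1) * (l.1 0 - l.2 1) + (k.1 1 + k.2 0) * (l.1 1 + l.2 0)) * (‖z‖ ^ 4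
          / ((1 + ‖z‖ ^ 2) ^ 2 * boostNormSq v z ^ 2))
      + 4 * (k.1 2 * l.1 2 + k.2 2 * l.2 2) * (‖z‖ ^ 2
          / ((1 + ‖z‖ ^ 2) ^ 2 * boostNormSq v z ^ 2))
      + ((k.1 0 + k.2 1) * (l.1 0 + l.2 1) + (k.2 0 - k.1 1) * (l.2 0 - l.1 1))
          * (1 / ((1 + ‖z‖ ^ 2) ^ 2 * boostNormSq v z ^ 2)) := by
  have hrot : ∀ c : ℂ, ‖c‖ = 1 → ∫ z, density v k l (c * z) = ∫ z, density v k l z := fun c hc => by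
    have := integral_moebius (a := c) (b := 0) (c := 0) (d := 1)
      (by simpa using norm_ne_zero_iff.1 (by rw [hc]; exact one_ne_zero)) (density v k l)
    simpa [hc] using this
  have hint : ∀ c : ℂ, ‖c‖ = 1 → Integrable fun z => density v k l (c * z) := fun c hc => by
    exact ((rotation ⟨c, mem_sphere_zero_iff_norm.2 hc⟩).measurePreserving.integrable_comp
      (continuous_density v k l).aestronglyMeasurable).2 (integrable_density v k l)
  have hI : ‖Complex.I‖ = 1 := Complex.norm_I
  have hm : ‖(-1 : ℂ)‖ = 1 := by simp
  have hmI : ‖-Complex.I‖ = 1 := by simp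
  have h4 : 4 * ∫ z, density v k l z = ∫ z, (density v k l z + density v k l (Complex.I * z)
      + density v k l (-1 * z) + density v k l (-Complex.I * z)) := by
    have i1 : Integrable fun z => density v k l z + density v k l (Complex.I * z) :=
      (integrable_density v k l).add (hint _ hI)
    have i2 : Integrable fun z => density v k l z + density v k l (Complex.I * z)
        + density v k l (-1 * z) := i1.add (hint _ hm)
    rw [integral_add i2 (hint _ hmI), integral_add i1 (hint _ hm),
      integral_add (integrable_density v k l) (hint _ hI), hrot _ hI, hrot _ hm, hrot _ hmI]
    ring
  have h5 : gram v k l = 2 * ((1 / 4) * (4 * ∫ z, density v k l z)) := by rw [gram]; ring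
  rw [h5, h4, ← integral_const_mul]
  congr 2
  funext z
  have hb : ∀ c : ℂ, ‖c‖ = 1 → boostNormSq v (c * z) = boostNormSq v z := fun c hc => by
    simp [boostNormSq, h0, h1, hc]
  simp only [density, hb _ hI, hb _ hm, hb _ hmI, norm_mul, hI, hm, hmI, one_mul]
  rw [← add_div, ← add_div, ← add_div, mul_div_assoc', mul_div_assoc', mul_div_assoc',
    mul_div_assoc', ← add_div, ← add_div]
  congr 1
  simp only [spinor]
  rw [average_quadratic]
  simp
  ring

theorem boostNormSq_axis (v : R3) (h0 : v 0 = 0) (h1 : v 1 = 0) (z : ℂ) :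
    boostNormSq v z = (lapse v + v 2) ^ 2 * ‖z‖ ^ 2 + (lapse v - v 2) ^ 2 := by
  have h := lapse_sq v
  simp only [dot, h0, h1] at h
  simp only [boostNormSq, dot, h0, h1]
  linear_combination (-(1 + ‖z‖ ^ 2)) * h

/-- With `m = lapse v + v 2`, the denominator is built from `1 + |z|²` and `m²|z|² + m⁻²`. The
inversion `z ↦ 1/(m² z)` exchanges these two up to factors, and thereby ties the moment of `1` to
that of `|z|⁴`. -/
theorem integral_axis_inversion (v : R3) (h0 : v 0 = 0) (h1 : v 1 = 0) :
    ∫ z : ℂ, 1 / ((1 + ‖z‖ ^ 2) ^ 2 * boostNormSq v z ^ 2) = (lapse v + v 2) ^ 4 *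
      ∫ z : ℂ, ‖z‖ ^ 4 / ((1 + ‖z‖ ^ 2) ^ 2 * boostNormSq v z ^ 2) := by
  have h := lapse_sq v
  simp only [dot, h0, h1] at h
  have hprod : (lapse v + v 2) * (lapse v - v 2) = 1 := by linear_combination h
  set m := lapse v + v 2 with hm
  have hm0 : m ≠ 0 := left_ne_zero_of_mul_eq_one hprod
  have hminv : lapse v - v 2 = m⁻¹ := eq_inv_of_mul_eq_one_right hprod
  have hb : ∀ z, boostNormSq v z = m ^ 2 * ‖z‖ ^ 2 + (m⁻¹) ^ 2 := fun z => by
    rw [boostNormSq_axis v h0 h1, hminv]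
  have hmC : ((m ^ 2 : ℝ) : ℂ) ≠ 0 := Complex.ofReal_ne_zero.2 (pow_ne_zero 2 hm0)
  rw [← integral_moebius (a := 0) (b := 1) (c := ((m ^ 2 : ℝ) : ℂ)) (d := 0)
    (by simpa using hm0) (fun z => ‖z‖ ^ 4 / ((1 + ‖z‖ ^ 2) ^ 2 * boostNormSq v z ^ 2)),
    ← integral_const_mul]
  apply integral_congr_ae
  filter_upwards [ae_mul_add_ne_zero (c := 1) (d := 0) (Or.inl one_ne_zero)] with z hz
  have hz' : 0 < ‖z‖ := norm_pos_iff.2 (by simpa using hz)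
  simp only [hb]
  have e : ‖((m ^ 2 : ℝ) : ℂ)‖ = m ^ 2 := by
    rw [Complex.norm_real, Real.norm_eq_abs, abs_of_nonneg (sq_nonneg m)]
  simp only [zero_mul, zero_add, add_zero, one_mul, zero_sub, norm_neg, norm_div, norm_mul, e,
    norm_one]
  generalize ‖z‖ = x at *
  have hm2 : 0 < m ^ 2 := by positivity
  have a1 : 0 < 1 + x ^ 2 := by positivity
  have a2 : 0 < 1 + m ^ 4 * x ^ 2 := by positivity
  have e1 : 1 + (1 / (m ^ 2 * x)) ^ 2 = (1 + m ^ 4 * x ^ 2) / (m ^ 4 * x ^ 2) := by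
    field_simp
    ring
  have e2 : m ^ 2 * (1 / (m ^ 2 * x)) ^ 2 + m⁻¹ ^ 2 = (1 + x ^ 2) / (m ^ 2 * x ^ 2) := by
    field_simp
  have e3 : m ^ 2 * x ^ 2 + m⁻¹ ^ 2 = (1 + m ^ 4 * x ^ 2) / m ^ 2 := by
    field_simp
    ring
  rw [e1, e2, e3]
  field_simp

theorem integrable_axis (v : R3) (j : ℕ) (hj : j ≤ 4) :
    Integrable fun z : ℂ => ‖z‖ ^ j / ((1 + ‖z‖ ^ 2) ^ 2 * boostNormSq v z ^ 2) := by
  refine (integrable_weight.const_mul ((2 * (1 + 2 * dot v v)) ^ 2)).mono' ?_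
    (Eventually.of_forall fun z => ?_)
  · refine Continuous.aestronglyMeasurable (Continuous.div (by fun_prop) ?_ fun z => ?_)
    · have := continuous_boostNormSq v
      fun_prop
    · have := boostNormSq_pos v z
      positivity
  · have hb := boostNormSq_pos v z
    have hN : (0 : ℝ) < 1 + ‖z‖ ^ 2 := by positivity
    have h3 : (boostNormSq v z)⁻¹ ^ 2 ≤ (2 * (1 + 2 * dot v v) * (1 + ‖z‖ ^ 2)⁻¹) ^ 2 :=
      pow_le_pow_left₀ (by positivity) (inv_boostNormSq_le v z) 2
    have hpow : ‖z‖ ^ j ≤ (1 + ‖z‖ ^ 2) ^ 2 := by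
      rcases le_total ‖z‖ 1 with h | h
      · calc ‖z‖ ^ j ≤ 1 := pow_le_one₀ (norm_nonneg z) h
          _ ≤ _ := by nlinarith [sq_nonneg ‖z‖]
      · calc ‖z‖ ^ j ≤ ‖z‖ ^ 4 := pow_le_pow_right₀ h hj
          _ ≤ _ := by nlinarith [sq_nonneg ‖z‖]
    rw [Real.norm_eq_abs, abs_of_nonneg (by positivity), weight]
    calc _ = ‖z‖ ^ j * ((1 + ‖z‖ ^ 2) ^ 2)⁻¹ * (boostNormSq v z)⁻¹ ^ 2 := by field_simp
      _ ≤ (1 + ‖z‖ ^ 2) ^ 2 * ((1 + ‖z‖ ^ 2) ^ 2)⁻¹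
          * (2 * (1 + 2 * dot v v) * (1 + ‖z‖ ^ 2)⁻¹) ^ 2 := by gcongr
      _ = _ := by field_simp

/-- The vector on the third axis. -/
def axis (r : ℝ) : R3 := EuclideanSpace.single 2 r

@[simp] theorem axis_zero (r : ℝ) : axis r 0 = 0 := by simp [axis]
@[simp] theorem axis_one (r : ℝ) : axis r 1 = 0 := by simp [axis]
@[simp] theorem axis_two (r : ℝ) : axis r 2 = r := by simp [axis]

/-- Transverse moment at `axis r`. -/
def transverse (r : ℝ) : ℝ :=
  gram (axis r) (EuclideanSpace.single 0 1, 0) (EuclideanSpace.single 0 1, 0)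

/-- Longitudinal moment at `axis r`. -/
def longitudinal (r : ℝ) : ℝ :=
  gram (axis r) (EuclideanSpace.single 2 1, 0) (EuclideanSpace.single 2 1, 0)

theorem transverse_pos (r : ℝ) : 0 < transverse r := gram_self_pos _ (by simp)

theorem longitudinal_pos (r : ℝ) : 0 < longitudinal r := gram_self_pos _ (by simp)

/-- Of the three radial moments the inversion leaves two independent ones; they are named by the
values of the form on the first and third unit vectors. -/
theorem gram_axis (r : ℝ) (k l : Coord) :
    gram (axis r) k l = transverse r * (k.1 0 * l.1 0 + k.1 1 * l.1 1 + k.2 0 * l.2 0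
        + k.2 1 * l.2 1)
      + longitudinal r * (k.1 2 * l.1 2 + k.2 2 * l.2 2)
      - transverse r * (2 * lapse (axis r) * r / (1 + 2 * r ^ 2)) *
        (k.2 0 * l.1 1 - k.2 1 * l.1 0 + l.2 0 * k.1 1 - l.2 1 * k.1 0) := by
  have h0 := axis_zero r
  have h1 := axis_one r
  set v := axis r with hv
  have hint := integrable_axis v
  have hgen : ∀ k l : Coord, gram v k l = 2 * (
      ((k.1 0 - k.2 1) * (l.1 0 - l.2 1) + (k.1 1 + k.2 0) * (l.1 1 + l.2 0)) *
        (∫ z : ℂ, ‖z‖ ^ 4 / ((1 + ‖z‖ ^ 2) ^ 2 * boostNormSq v z ^ 2))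
      + 4 * (k.1 2 * l.1 2 + k.2 2 * l.2 2) *
        (∫ z : ℂ, ‖z‖ ^ 2 / ((1 + ‖z‖ ^ 2) ^ 2 * boostNormSq v z ^ 2))
      + ((k.1 0 + k.2 1) * (l.1 0 + l.2 1) + (k.2 0 - k.1 1) * (l.2 0 - l.1 1)) *
        ((lapse v + v 2) ^ 4 *
          ∫ z : ℂ, ‖z‖ ^ 4 / ((1 + ‖z‖ ^ 2) ^ 2 * boostNormSq v z ^ 2))) := fun k l => by
    have i0 := hint 0 (by norm_num)
    simp only [pow_zero] at i0
    rw [gram_eq_average v h0 h1, ← integral_axis_inversion v h0 h1,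
      integral_linear_combination (hint 4 le_rfl) (hint 2 (by norm_num)) i0]
  have h2 : v 2 = r := axis_two r
  have hs : transverse r = gram v (EuclideanSpace.single 0 1, 0) (EuclideanSpace.single 0 1, 0) :=
    rfl
  have ht : longitudinal r = gram v (EuclideanSpace.single 2 1, 0) (EuclideanSpace.single 2 1, 0) :=
    rfl
  rw [hgen, h2] at hs ht
  simp at hs ht
  have hl := lapse_sq v
  simp only [dot, h0, h1, h2] at hl
  rw [hgen, hs, ht, h2]
  generalize (∫ z : ℂ, ‖z‖ ^ 4 / ((1 + ‖z‖ ^ 2) ^ 2 * boostNormSq v z ^ 2)) = J at *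
  generalize lapse v = m at *
  have ha : (1 + 2 * r ^ 2) ≠ 0 := by positivity
  -- Put `α = 1 + 2r²`, `β = 2mr` and `M = m + r`. Then `M² = α + β` and `M⁻² = α - β`, so `(M⁴ -
  -- 1)/(M⁴ + 1) = β/α`.
  have key : (J + (m + r) ^ 4 * J) * (2 * m * r / (1 + 2 * r ^ 2)) = ((m + r) ^ 4 - 1) * J := by
    rw [mul_div_assoc', div_eq_iff ha]
    have hM : (m + r) ^ 2 = (1 + 2 * r ^ 2) + 2 * m * r := by linear_combination hl
    have hab : (1 + 2 * r ^ 2) ^ 2 - (2 * m * r) ^ 2 = 1 := by linear_combination (-4 * r ^ 2) * hl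
    rw [show (m + r) ^ 4 = ((m + r) ^ 2) ^ 2 by ring, hM]
    linear_combination (-((1 + 2 * r ^ 2) + 2 * m * r) * J) * hab
  linear_combination (2 * (k.2 0 * l.1 1 - k.2 1 * l.1 0 + l.2 0 * k.1 1 - l.2 1 * k.1 0)) * key

end

noncomputable section

set_option maxSynthPendingDepth 3

/-! ## The metric as a differentiable field of bilinear forms -/

theorem frame_add (q u v : Coord) : frame q (u + v) = frame q u + frame q v := by
  ext i <;> fin_cases i <;> simp [frame, frameRe, frameIm, leftForm, dot] <;> ring

theorem frame_smul (q : Coord) (c : ℝ) (u : Coord) : frame q (c • u) = c • frame q u := by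
  ext i <;> fin_cases i <;> simp [frame, frameRe, frameIm, leftForm, dot] <;> ring

/-- `frame q` as a continuous linear map. -/
def frameL (q : Coord) : Coord →L[ℝ] Coord :=
  LinearMap.toContinuousLinearMap
    { toFun := frame q, map_add' := frame_add q, map_smul' := frame_smul q }

section ContDiff

variable {E : Type*} [NormedAddCommGroup E] [NormedSpace ℝ E] {n : WithTop ℕ∞} {f g : E → R3}

theorem contDiff_component (hf : ContDiff ℝ n f) (i : Fin 3) : ContDiff ℝ n fun x => f x i :=
  (contDiff_coord i).comp hf

theorem contDiff_dot (hf : ContDiff ℝ n f) (hg : ContDiff ℝ n g) :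
    ContDiff ℝ n fun x => dot (f x) (g x) := by
  have hf := contDiff_component hf
  have hg := contDiff_component hg
  exact (((hf 0).mul (hg 0)).add ((hf 1).mul (hg 1))).add ((hf 2).mul (hg 2))

theorem contDiff_cross (hf : ContDiff ℝ n f) (hg : ContDiff ℝ n g) :
    ContDiff ℝ n fun x => cross (f x) (g x) := by
  have hf := contDiff_component hf
  have hg := contDiff_component hg
  refine contDiff_euclidean.2 fun i => ?_
  fin_cases i
  · exact ((hf 1).mul (hg 2)).sub ((hf 2).mul (hg 1))
  · exact ((hf 2).mul (hg 0)).sub ((hf 0).mul (hg 2))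
  · exact ((hf 0).mul (hg 1)).sub ((hf 1).mul (hg 0))

end ContDiff

theorem contDiff_frame (u : Coord) : ContDiff ℝ 1 fun q => frame q u := by
  have h1 : ContDiff ℝ 1 fun q : Coord => q.1 := contDiff_fst
  have h2 : ContDiff ℝ 1 fun q : Coord => q.2 := contDiff_snd
  have c1 : ContDiff ℝ 1 fun _ : Coord => u.1 := contDiff_const
  have c2 : ContDiff ℝ 1 fun _ : Coord => u.2 := contDiff_const
  have hl : ContDiff ℝ 1 fun q : Coord => lapse q.2 :=
    (contDiff_lapse.of_le (by norm_num)).comp contDiff_snd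
  have hs : ContDiff ℝ 1 fun q : Coord => leftForm q.1 u.1 := by
    refine ContDiff.smul (ContDiff.inv (contDiff_const.add ((contDiff_dot h1 h1).div_const 4))
      fun q => ?_) (c1.add (contDiff_cross h1 c1 |>.const_smul _))
    have := dot_self_nonneg q.1
    positivity
  refine ContDiff.prodMk ?_ ?_
  · exact (hl.smul (c2.sub (contDiff_cross hs h2))).sub
      (((contDiff_dot h2 c2).div hl fun q => lapse_ne_zero _).smul h2)
  · exact (((contDiff_const.add (contDiff_dot h2 h2)).smul hs).sub
      ((contDiff_dot h2 hs).smul h2)).sub (contDiff_cross h2 c2)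

/-- The `L²` metric as a field of continuous bilinear forms. -/
def metricL (q : Coord) : Coord →L[ℝ] Coord →L[ℝ] ℝ :=
  (gramL q.2).bilinearComp (frameL q) (frameL q)

theorem metricL_apply (q u v : Coord) :
    metricL q u v = gram q.2 (frame q u) (frame q v) := rfl

theorem lumpMetric_eq (U : SU2) (q u v : Coord) : lumpMetric U q u v = metricL q u v := by
  rw [lumpMetric_eq_gram, metricL_apply]

theorem contDiff_metricL : ContDiff ℝ 1 metricL := by
  refine contDiff_clm_apply_iff.2 fun u => contDiff_clm_apply_iff.2 fun v => ?_
  exact ((contDiff_gramL.comp contDiff_snd).clm_apply (contDiff_frame u)).clm_apply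
    (contDiff_frame v)

theorem metricL_comm (q u v : Coord) : metricL q u v = metricL q v u := gram_comm _ _ _

/-- With `s` the left form of the SO(3) part: pairing the real part with `v` gives `v·a = 0`, hence
`a = s × v`; pairing the imaginary part with `v` gives `v·s = 0`. Then `v × (s × v) = |v|² s`
reduces the imaginary part to `s/2 = 0`. This makes the metric positive definite in coordinates. -/
theorem frame_eq_zero {q u : Coord} (h : frame q u = 0) : u = 0 := by
  obtain ⟨ξ, v⟩ := q
  obtain ⟨η, a⟩ := u
  have hl := lapse_ne_zero v
  have hsq := lapse_sq v
  have h1 : ∀ i, frameRe v (leftForm ξ η) a i = 0 := fun i =>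
    congrFun (congrArg WithLp.ofLp (congrArg Prod.fst h)) i
  have h2 : ∀ i, frameIm v (leftForm ξ η) a i = 0 := fun i =>
    congrFun (congrArg WithLp.ofLp (congrArg Prod.snd h)) i
  have hσ : leftForm ξ η = 0 → η = 0 := fun hσ => by
    have h3 : 1 + dot ξ ξ / 4 ≠ 0 := by have := dot_self_nonneg ξ; positivity
    have h4 : η + (1 / 2 : ℝ) • cross ξ η = 0 := by
      rw [leftForm] at hσ
      exact (smul_eq_zero.1 hσ).resolve_left (inv_ne_zero h3)
    have h5 : ∀ i, (η + (1 / 2 : ℝ) • cross ξ η) i = 0 := fun i => by rw [h4]; rfl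
    have h50 := h5 0
    have h51 := h5 1
    have h52 := h5 2
    simp at h50 h51 h52
    have h6 : ‖η‖ ^ 2 = 0 := by
      rw [norm_sq_eq_dot, dot]
      linear_combination η 0 * h50 + η 1 * h51 + η 2 * h52
    simpa using h6
  generalize leftForm ξ η = σ at *
  have a0 := h1 0
  have a1 := h1 1
  have a2 := h1 2
  have b0 := h2 0
  have b1 := h2 1
  have b2 := h2 2
  simp [frameRe] at a0 a1 a2
  simp [frameIm] at b0 b1 b2
  have hva : dot v a = 0 := by
    have : dot v a / lapse v = 0 := by
      have e : dot v a / lapse v * lapse v = dot v a := div_mul_cancel₀ _ hl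
      generalize dot v a / lapse v = x at *
      rw [dot] at e hsq
      linear_combination v 0 * a0 + v 1 * a1 + v 2 * a2 + lapse v * e - x * hsq
    exact (div_eq_zero_iff.1 this).resolve_right hl
  simp only [hva, zero_div, zero_mul, sub_zero, mul_eq_zero, hl, false_or] at a0 a1 a2
  have hvσ : dot v σ = 0 := by
    rw [dot] at b0 b1 b2 ⊢
    rw [dot] at b0 b1 b2
    linear_combination 2 * (v 0 * b0 + v 1 * b1 + v 2 * b2)
  simp only [hvσ, zero_mul, sub_zero] at b0 b1 b2
  rw [dot] at b0 b1 b2 hvσ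
  have s0 : σ 0 = 0 := by
    linear_combination 2 * b0 + 2 * (v 1 * a2 - v 2 * a1) - 2 * v 0 * hvσ
  have s1 : σ 1 = 0 := by
    linear_combination 2 * b1 + 2 * (v 2 * a0 - v 0 * a2) - 2 * v 1 * hvσ
  have s2 : σ 2 = 0 := by
    linear_combination 2 * b2 + 2 * (v 0 * a1 - v 1 * a0) - 2 * v 2 * hvσ
  have hσ0 : σ = 0 := by ext i; fin_cases i <;> simp [s0, s1, s2]
  have ha : a = 0 := by
    simp only [s0, s1, s2, zero_mul, sub_zero] at a0 a1 a2
    ext i; fin_cases i <;> simp [a0, a1, a2]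
  rw [hσ hσ0, ha]
  rfl

theorem metricL_self_pos (q : Coord) {u : Coord} (hu : u ≠ 0) : 0 < metricL q u u :=
  gram_self_pos _ fun h => hu (frame_eq_zero h)

theorem hasFDerivAt_metricL (q : Coord) : HasFDerivAt metricL (fderiv ℝ metricL q) q :=
  (contDiff_metricL.differentiable (by norm_num) q).hasFDerivAt

theorem continuous_fderiv_metricL : Continuous (fderiv ℝ metricL) :=
  contDiff_metricL.continuous_fderiv (by norm_num)

theorem fderiv_lumpMetric (U : SU2) (p u v w : Coord) :
    fderiv ℝ (fun q => lumpMetric U q u v) p w = fderiv ℝ metricL p w u v := by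
  simp only [lumpMetric_eq]
  have h := ((hasFDerivAt_metricL p).clm_apply (hasFDerivAt_const u p)).clm_apply
    (hasFDerivAt_const v p)
  rw [h.fderiv]
  simp

theorem fderiv_metricL_comm (p u v w : Coord) :
    fderiv ℝ metricL p w u v = fderiv ℝ metricL p w v u := by
  rw [← fderiv_lumpMetric 1, ← fderiv_lumpMetric 1]
  simp only [lumpMetric_eq]
  congr 2
  funext q
  exact metricL_comm q u v

theorem christoffel_eq (U : SU2) (p u v w : Coord) :
    christoffel U p u v w = (1 / 2) * (fderiv ℝ metricL p u v w + fderiv ℝ metricL p v u w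
      - fderiv ℝ metricL p w u v) := by
  simp only [christoffel, fderiv_lumpMetric]

/-- Derivative of the metric along a curve of points and two curves of vectors. -/
theorem hasDerivAt_metricL_curve {c u v : ℝ → Coord} {c' u' v' : Coord} {t : ℝ}
    (hc : HasDerivAt c c' t) (hu : HasDerivAt u u' t) (hv : HasDerivAt v v' t) :
    HasDerivAt (fun s => metricL (c s) (u s) (v s))
      (fderiv ℝ metricL (c t) c' (u t) (v t) + metricL (c t) u' (v t)
        + metricL (c t) (u t) v') t := by
  have h1 : HasDerivAt (fun s => metricL (c s)) (fderiv ℝ metricL (c t) c') t :=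
    (hasFDerivAt_metricL (c t)).comp_hasDerivAt t hc
  have := (h1.clm_apply hu).clm_apply hv
  simpa [add_assoc] using this

/-! ## Symmetries of the metric -/

theorem metricL_rotation {R : R3 →ₗ[ℝ] R3} (hR : IsRotation R)
    (hg : ∀ v k l, gram (R v) (R.prodMap R k) (R.prodMap R l) = gram v k l) (q u v : Coord) :
    metricL (R.prodMap R q) (R.prodMap R u) (R.prodMap R v) = metricL q u v := by
  rw [metricL_apply, metricL_apply, frame_rotation hR, frame_rotation hR]
  exact hg _ _ _

theorem metricL_rotY (θ : ℝ) (q u v : Coord) :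
    metricL ((rotY θ).prodMap (rotY θ) q) ((rotY θ).prodMap (rotY θ) u)
      ((rotY θ).prodMap (rotY θ) v) = metricL q u v :=
  metricL_rotation (isRotation_rotY θ) (gram_rotY θ) q u v

theorem metricL_rotX (θ : ℝ) (q u v : Coord) :
    metricL ((rotX θ).prodMap (rotX θ) q) ((rotX θ).prodMap (rotX θ) u)
      ((rotX θ).prodMap (rotX θ) v) = metricL q u v :=
  metricL_rotation (isRotation_rotX θ) (gram_rotX θ) q u v

theorem leftForm_zero (η : R3) : leftForm 0 η = η := by
  ext i; fin_cases i <;> simp [leftForm, dot]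

theorem metricL_leftForm (q u v : Coord) :
    metricL q u v = metricL (0, q.2) (leftForm q.1 u.1, u.2) (leftForm q.1 v.1, v.2) := by
  simp only [metricL_apply, frame, leftForm_zero]

/-- The left invariant vector field generated by `n`, at `cayley ξ`. -/
def leftField (ξ n : R3) : R3 := n - (1 / 2 : ℝ) • cross ξ n + (dot ξ n / 4) • ξ

theorem leftForm_leftField (ξ n : R3) : leftForm ξ (leftField ξ n) = n := by
  have h : 1 + dot ξ ξ / 4 ≠ 0 := by have := dot_self_nonneg ξ; positivity
  have e : leftField ξ n + (1 / 2 : ℝ) • cross ξ (leftField ξ n) = (1 + dot ξ ξ / 4) • n := by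
    ext i; fin_cases i <;> simp [leftField, dot] <;> ring
  rw [leftForm, e, smul_smul, inv_mul_cancel₀ h, one_smul]

theorem leftField_zero (n : R3) : leftField 0 n = n := by
  ext i; fin_cases i <;> simp [leftField, dot]

/-! ## The normal field of the hypersurface -/

/-- The unit vector of the second axis. -/
def e2 : R3 := EuclideanSpace.single 1 1

@[simp] theorem e2_zero : e2 0 = 0 := by simp [e2]
@[simp] theorem e2_one : e2 1 = 1 := by simp [e2]
@[simp] theorem e2_two : e2 2 = 0 := by simp [e2]

/-- The component of the normal field along `SO(3)`. -/
def spin (v : R3) : R3 := (-2 / (1 + 2 * dot v v)) • cross e2 v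

/-- A normal field of the hypersurface. -/
def normalField (q : Coord) : Coord := (leftField q.1 (spin q.2), e2)

theorem one_add_two_dot_pos (v : R3) : 0 < 1 + 2 * dot v v := by
  have := dot_self_nonneg v; positivity

/-- The coefficient in `spin` is chosen to make the imaginary part vanish: `(1/2 + |v|²) s = v ×
e2`. This is what makes the field orthogonal to `H`. -/
theorem frame_normalField (q : Coord) (h : q.2 1 = 0) :
    frame q (normalField q) = ((lapse q.2 / (1 + 2 * dot q.2 q.2)) • e2, 0) := by
  have hα := (one_add_two_dot_pos q.2).ne'
  rw [frame, normalField, leftForm_leftField]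
  generalize q.2 = v at *
  ext i
  · fin_cases i <;> simp [frameRe, spin, h, dot] at *
    field_simp
    ring
  · fin_cases i <;> simp [frameIm, spin, h, dot] at * <;> field_simp <;> ring

theorem exists_rotY_axis (v : R3) (h : v 1 = 0) : ∃ θ r : ℝ, 0 ≤ r ∧ v = rotY θ (axis r) := by
  set z : ℂ := ⟨v 2, v 0⟩
  refine ⟨z.arg, ‖z‖, norm_nonneg z, ?_⟩
  have h1 := Complex.norm_mul_cos_arg z
  have h2 := Complex.norm_mul_sin_arg z
  ext i
  fin_cases i <;> simp [h]
  · rw [mul_comm, h2]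
  · rw [mul_comm, h1]

theorem frame_axis (r : ℝ) (u : Coord) :
    frame (0, axis r) u = (!₂[lapse (axis r) * (u.2 0 - r * u.1 1),
        lapse (axis r) * (u.2 1 + r * u.1 0), u.2 2 / lapse (axis r)],
      !₂[(1 / 2 + r ^ 2) * u.1 0 + r * u.2 1, (1 / 2 + r ^ 2) * u.1 1 - r * u.2 0,
        u.1 2 / 2]) := by
  have hl := lapse_ne_zero (axis r)
  have hsq := lapse_sq (axis r)
  simp only [dot, axis_zero, axis_one, axis_two] at hsq
  rw [frame, leftForm_zero]
  ext i
  · fin_cases i <;> simp [frameRe, dot]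
    · left; ring
    · left; ring
    · field_simp
      linear_combination u.2 2 * hsq
  · fin_cases i <;> simp [frameIm, dot, pow_two]
    ring

theorem rotY_e2 (θ : ℝ) : rotY θ e2 = e2 := by
  ext i; fin_cases i <;> simp

/-- After rotating to the third axis, the real second unit vector pairs only with the second real
and first imaginary components of the other frame. For a tangent vector both are multiples of its
`σ₁` component, and they cancel. -/
theorem metricL_normalField (q w : Coord) (h : q.2 1 = 0) (hw : w.2 1 = 0) :
    metricL q (normalField q) w = 0 := by
  obtain ⟨θ, r, -, hv⟩ := exists_rotY_axis q.2 h
  have hα := (one_add_two_dot_pos q.2).ne'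
  rw [metricL_apply, frame_normalField q h]
  have hinv : ∀ x : R3, rotY θ (rotY (-θ) x) = x := fun x => by
    have := Real.sin_sq_add_cos_sq θ
    ext i; fin_cases i <;> simp
    · linear_combination x 0 * this
    · linear_combination x 2 * this
  set u : Coord := (rotY (-θ) (leftForm q.1 w.1), rotY (-θ) w.2) with hu
  have hu1 : u.2 1 = 0 := by simp [hu, hw]
  have h1 : frame q w = (rotY θ).prodMap (rotY θ) (frame (0, axis r) u) := by
    rw [← frame_rotation (isRotation_rotY θ)]
    simp only [frame, LinearMap.prodMap_apply, map_zero, leftForm_zero, hu, hinv, hv]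
  set c := lapse q.2 / (1 + 2 * dot q.2 q.2)
  have h2 : ((c • e2, 0) : Coord) = (rotY θ).prodMap (rotY θ) (c • e2, 0) := by
    simp [rotY_e2]
  rw [h1, h2, hv, gram_rotY, gram_axis, frame_axis]
  simp [hu1]
  have : 1 + 2 * r ^ 2 ≠ 0 := by positivity
  field_simp
  ring

/-! ## The second fundamental form -/

theorem mem_tangentH {u : Coord} : u ∈ tangentH ↔ u.2 1 = 0 := Iff.rfl

/-- The second fundamental form of the hypersurface at `p` with respect to the normal vector `n`,
on constant vector fields. -/
def secondForm (p n u v : Coord) : ℝ :=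
  (1 / 2) * (fderiv ℝ metricL p n u v - fderiv ℝ metricL p u n v - fderiv ℝ metricL p v n u)

theorem secondForm_comm (p n u v : Coord) : secondForm p n u v = secondForm p n v u := by
  rw [secondForm, secondForm, fderiv_metricL_comm p u v n]; ring

theorem secondForm_add_self (p n u v : Coord) : secondForm p n (u + v) (u + v)
    = secondForm p n u u + 2 * secondForm p n u v + secondForm p n v v := by
  have := fderiv_metricL_comm p u v n
  simp only [secondForm, map_add, add_apply]
  linear_combination (-1 / 2) * this

theorem secondForm_smul_left (p : Coord) (c : ℝ) (n u v : Coord) :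
    secondForm p (c • n) u v = c * secondForm p n u v := by
  simp only [secondForm, map_smul, smul_apply, smul_eq_mul]
  ring

theorem christoffel_eq_neg_secondForm (U : SU2) (p u n : Coord) :
    christoffel U p u u n = -secondForm p n u u := by
  rw [christoffel_eq, secondForm, fderiv_metricL_comm p u n u]; ring

theorem hasDerivAt_line (p u : Coord) : HasDerivAt (fun t : ℝ => p + t • u) u 0 := by
  simpa using ((hasDerivAt_id (0 : ℝ)).smul_const u).const_add p

/-- The derivative of `γ(N, u) = 0` along the segment `p + t v`, which stays in the hypersurface
because `H` is linear in these coordinates. -/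
theorem fderiv_metricL_normal {p : Coord} (hp : p.2 1 = 0) {N : Coord → Coord}
    (hN : DifferentiableAt ℝ N p)
    (h : ∀ᶠ q in 𝓝 p, q.2 1 = 0 → ∀ w ∈ tangentH, metricL q (N q) w = 0)
    {u v : Coord} (hu : u ∈ tangentH) (hv : v ∈ tangentH) :
    fderiv ℝ metricL p v (N p) u + metricL p (fderiv ℝ N p v) u = 0 := by
  have hl := hasDerivAt_line p v
  have hp0 : p + (0 : ℝ) • v = p := by simp
  have hN' : HasDerivAt (fun t : ℝ => N (p + t • v)) (fderiv ℝ N p v) 0 := by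
    have : HasFDerivAt N (fderiv ℝ N p) (p + (0 : ℝ) • v) := by rw [hp0]; exact hN.hasFDerivAt
    exact this.comp_hasDerivAt 0 hl
  have h1 := hasDerivAt_metricL_curve hl hN' (hasDerivAt_const (0 : ℝ) u)
  rw [hp0, map_zero, add_zero] at h1
  have h2 : ∀ᶠ t : ℝ in 𝓝 0, metricL (p + t • v) (N (p + t • v)) u = 0 := by
    have hc : Tendsto (fun t : ℝ => p + t • v) (𝓝 0) (𝓝 p) := by
      simpa using hl.continuousAt.tendsto
    filter_upwards [hc.eventually h] with t ht
    refine ht ?_ u hu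
    have hv' : v.2 1 = 0 := hv
    simp [hp, hv']
  exact h1.unique ((hasDerivAt_const (0 : ℝ) (0 : ℝ)).congr_of_eventuallyEq h2)

/-- Orthogonality trades the derivative of `N` for a derivative of the metric. What remains sees `N`
only through `N p` and is visibly symmetric in `u` and `v`. -/
theorem formB_eq_secondForm {U : SU2} {p : Coord} (hp : p.2 1 = 0) {N : Coord → Coord}
    (hN : IsNormalFieldAt U p N) {u v : Coord} (hu : u ∈ tangentH) (hv : v ∈ tangentH) :
    formB U p N u v = secondForm p (N p) u v := by
  have h := fderiv_metricL_normal hp (hN.1.differentiableAt (by norm_num))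
    (hN.2.mono fun q hq hq1 w hw => by rw [← lumpMetric_eq U]; exact (hq hq1).2 w hw) hu hv
  rw [formB, lumpMetric_eq, christoffel_eq, metricL_comm p u, secondForm]
  linear_combination h + (1 / 2) * fderiv_metricL_comm p v u (N p)
    - (1 / 2) * fderiv_metricL_comm p v (N p) u

theorem contDiff_normalField : ContDiff ℝ 1 normalField := by
  have h1 : ContDiff ℝ 1 fun q : Coord => q.1 := contDiff_fst
  have h2 : ContDiff ℝ 1 fun q : Coord => q.2 := contDiff_snd
  have c2 : ContDiff ℝ 1 fun _ : Coord => e2 := contDiff_const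
  have hs : ContDiff ℝ 1 fun q : Coord => spin q.2 :=
    ContDiff.smul (contDiff_const.div (contDiff_const.add (contDiff_const.mul (contDiff_dot h2 h2)))
      fun q => (one_add_two_dot_pos q.2).ne') (contDiff_cross c2 h2)
  exact ContDiff.prodMk ((hs.sub (contDiff_cross h1 hs |>.const_smul _)).add
    (((contDiff_dot h1 hs).div_const 4).smul h1)) c2

theorem isNormalFieldAt_normalField (U : SU2) (p : Coord) : IsNormalFieldAt U p normalField := by
  refine ⟨contDiff_normalField.contDiffAt, Eventually.of_forall fun q hq => ⟨fun h => ?_,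
    fun w hw => ?_⟩⟩
  · have : e2 1 = 0 := by
      rw [show e2 = 0 from congrArg Prod.snd h]; rfl
    simp at this
  · rw [lumpMetric_eq]
    exact metricL_normalField q w hq hw

/-- Subtracting the multiple with the same `λ₂` component leaves a vector that is both tangent and
normal, hence zero. Changing `N` therefore only rescales `B`. -/
theorem exists_smul_normalField {U : SU2} {p : Coord} (hp : p.2 1 = 0) {N : Coord → Coord}
    (hN : IsNormalFieldAt U p N) : ∃ c : ℝ, c ≠ 0 ∧ N p = c • normalField p := by
  obtain ⟨h0, h1⟩ := hN.2.self_of_nhds hp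
  refine ⟨(N p).2 1, ?_⟩
  have hd : N p - (N p).2 1 • normalField p = 0 := by
    by_contra hne
    have hmem : N p - (N p).2 1 • normalField p ∈ tangentH := by
      rw [mem_tangentH]; simp [normalField]
    have hpos := metricL_self_pos p hne
    have hN1 := h1 _ hmem
    rw [lumpMetric_eq] at hN1
    have hN2 := metricL_normalField p _ hp hmem
    set d := N p - (N p).2 1 • normalField p
    have hd : metricL p d d = metricL p d (N p) - (N p).2 1 * metricL p d (normalField p) := by
      rw [← smul_eq_mul, ← map_smul, ← map_sub]
    rw [hd, metricL_comm p d, metricL_comm p d, hN1, hN2] at hpos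
    simp at hpos
  rw [sub_eq_zero] at hd
  refine ⟨fun hc => h0 ?_, hd⟩
  rw [hd, hc, zero_smul]

/-! ## The second fundamental form on the third axis -/

/-- The generator of the rotations about the first axis. -/
def genX (w : R3) : R3 := !₂[0, -w 2, w 1]

theorem hasDerivAt_rotX (w : R3) : HasDerivAt (fun θ : ℝ => rotX θ w) (genX w) 0 := by
  have e : (fun θ : ℝ => rotX θ w) = fun θ : ℝ => !₂[w 0, 0, 0] + Real.cos θ • !₂[0, w 1, w 2]
      + Real.sin θ • genX w := by
    funext θ
    ext i
    fin_cases i <;> simp [genX] <;> ring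
  rw [e]
  have := (((Real.hasDerivAt_cos 0).smul_const (!₂[0, w 1, w 2] : R3)).const_add
    (!₂[w 0, 0, 0] : R3)).fun_add ((Real.hasDerivAt_sin 0).smul_const (genX w))
  simpa using this

/-- An infinitesimal rotation about the first axis moves `axis r` along `-r e2`. Invariance of the
metric then gives its derivative transverse to `H` without differentiating the integral, at the
price of the factor `r`. -/
theorem fderiv_metricL_e2 (r : ℝ) (u v : Coord) :
    r * fderiv ℝ metricL (0, axis r) (0, e2) u v
      = metricL (0, axis r) (genX u.1, genX u.2) v + metricL (0, axis r) u (genX v.1, genX v.2) := by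
  have hd : ∀ w : Coord, HasDerivAt (fun θ : ℝ => (rotX θ).prodMap (rotX θ) w)
      (genX w.1, genX w.2) 0 := fun w => (hasDerivAt_rotX w.1).prodMk (hasDerivAt_rotX w.2)
  have h0 : ∀ w : Coord, (rotX 0).prodMap (rotX 0) w = w := fun w => by
    ext i <;> fin_cases i <;> simp
  have h1 := hasDerivAt_metricL_curve (hd (0, axis r)) (hd u) (hd v)
  simp only [metricL_rotX, h0] at h1
  have h2 := h1.unique (hasDerivAt_const _ _)
  have e : ((genX 0, genX (axis r)) : Coord) = (-r) • (0, e2) := by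
    ext i <;> fin_cases i <;> simp [genX]
  rw [e, map_smul, smul_apply, smul_apply,
    smul_eq_mul] at h2
  linear_combination -h2

theorem hasDerivAt_leftForm (n η : R3) :
    HasDerivAt (fun t : ℝ => leftForm (t • n) η) ((1 / 2 : ℝ) • cross n η) 0 := by
  have e : (fun t : ℝ => leftForm (t • n) η) = fun t : ℝ => (1 + dot n n / 4 * t ^ 2)⁻¹ •
      (η + t • (1 / 2 : ℝ) • cross n η) := by
    funext t
    rw [leftForm]
    congr 1
    · simp [dot]; ring
    · ext i; fin_cases i <;> simp <;> ring
  rw [e]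
  have h1 : HasDerivAt (fun t : ℝ => (1 + dot n n / 4 * t ^ 2)⁻¹) 0 0 := by
    have := (((hasDerivAt_pow 2 (0 : ℝ)).const_mul (dot n n / 4)).const_add 1).fun_inv (by simp)
    simpa using this
  have h2 := ((hasDerivAt_id (0 : ℝ)).smul_const ((1 / 2 : ℝ) • cross n η)).const_add η
  simpa using h1.fun_smul h2

/-- The metric depends on `ξ` only through `leftForm`, whose derivative at the identity is half the
Lie bracket. -/
theorem fderiv_metricL_left (v n : R3) (u w : Coord) :
    fderiv ℝ metricL (0, v) (n, 0) u w
      = metricL (0, v) ((1 / 2 : ℝ) • cross n u.1, 0) w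
        + metricL (0, v) u ((1 / 2 : ℝ) • cross n w.1, 0) := by
  have hl : HasDerivAt (fun t : ℝ => ((t • n, v) : Coord)) (n, 0) 0 := by
    have : HasDerivAt (fun t : ℝ => t • n) n 0 := by
      simpa using (hasDerivAt_id (0 : ℝ)).smul_const n
    exact this.prodMk (hasDerivAt_const _ _)
  have h1 := hasDerivAt_metricL_curve hl (hasDerivAt_const (0 : ℝ) u) (hasDerivAt_const (0 : ℝ) w)
  have hd : ∀ u : Coord, HasDerivAt (fun t : ℝ => ((leftForm (t • n) u.1, u.2) : Coord))
      ((1 / 2 : ℝ) • cross n u.1, 0) 0 := fun u =>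
    (hasDerivAt_leftForm n u.1).prodMk (hasDerivAt_const _ _)
  have h2 := hasDerivAt_metricL_curve (hasDerivAt_const (0 : ℝ) ((0, v) : Coord)) (hd u) (hd w)
  have e : (fun t : ℝ => metricL (t • n, v) u w)
      = fun t : ℝ => metricL (0, v) (leftForm (t • n) u.1, u.2) (leftForm (t • n) w.1, w.2) :=
    funext fun t => metricL_leftForm _ _ _
  rw [e] at h1
  have h3 := h1.unique h2
  simpa [leftForm_zero] using h3

theorem spin_axis (r : ℝ) : spin (axis r) = !₂[-2 * r / (1 + 2 * r ^ 2), 0, 0] := by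
  ext i
  fin_cases i <;> simp [spin, dot]
  ring

theorem fderiv_normalField_axis (r : ℝ) (u : Coord) :
    fderiv ℝ normalField (0, axis r) u =
      (!₂[(8 * r ^ 2 / (1 + 2 * r ^ 2) ^ 2 - 2 / (1 + 2 * r ^ 2)) * u.2 2, 0,
        2 / (1 + 2 * r ^ 2) * u.2 0] - (1 / 2 : ℝ) • cross u.1 (spin (axis r)), 0) := by
  have hα : 1 + 2 * r ^ 2 ≠ 0 := by positivity
  have hl := hasDerivAt_line (0, axis r) u
  have h1 : HasDerivAt (fun t : ℝ => normalField ((0, axis r) + t • u))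
      (fderiv ℝ normalField (0, axis r) u) 0 := by
    have : HasFDerivAt normalField (fderiv ℝ normalField (0, axis r))
        (((0, axis r) : Coord) + (0 : ℝ) • u) := by
      rw [zero_smul, add_zero]
      exact (contDiff_normalField.differentiable (by norm_num) _).hasFDerivAt
    exact this.comp_hasDerivAt 0 hl
  refine h1.unique ?_
  -- Along the line the spin part is `k t • (c0 + t • c1)`. The facts `hn`, `hx` and `hy`
  -- differentiate the three terms of `leftField`; the last is of order `t²` and contributes
  -- nothing.
  set k : ℝ → ℝ := fun t => -2 / (1 + 2 * r ^ 2 + 4 * r * u.2 2 * t + 2 * dot u.2 u.2 * t ^ 2)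
  have hk : HasDerivAt k (8 * r * u.2 2 / (1 + 2 * r ^ 2) ^ 2) 0 := by
    have hd := (((hasDerivAt_id (0 : ℝ)).const_mul (4 * r * u.2 2)).const_add
      (1 + 2 * r ^ 2)).fun_add ((hasDerivAt_pow 2 (0 : ℝ)).const_mul (2 * dot u.2 u.2))
    have := (hasDerivAt_const (0 : ℝ) (-2 : ℝ)).fun_div hd (by simpa using hα)
    refine this.congr_deriv ?_
    simp
    ring
  have hid := hasDerivAt_id (0 : ℝ)
  set c0 := cross e2 (axis r)
  set c1 := cross e2 u.2
  have hn : HasDerivAt (fun t : ℝ => k t • (c0 + t • c1))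
      ((8 * r * u.2 2 / (1 + 2 * r ^ 2) ^ 2) • c0 + (-2 / (1 + 2 * r ^ 2)) • c1) 0 := by
    have := hk.fun_smul ((hid.smul_const c1).const_add c0)
    refine this.congr_deriv ?_
    simp [k, add_comm]
  have hx : HasDerivAt (fun t : ℝ => (t * k t / 2) • (cross u.1 c0 + t • cross u.1 c1))
      ((-2 / (1 + 2 * r ^ 2) / 2) • cross u.1 c0) 0 := by
    have := ((hid.fun_mul hk).div_const 2).fun_smul
      ((hid.smul_const (cross u.1 c1)).const_add (cross u.1 c0))
    refine this.congr_deriv ?_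
    simp [k]
  have hy : HasDerivAt (fun t : ℝ => (t ^ 2 * (k t * (dot u.1 c0 + t * dot u.1 c1) / 4)) • u.1)
      0 0 := by
    have := ((hasDerivAt_pow 2 (0 : ℝ)).fun_mul ((hk.fun_mul
      ((hid.mul_const (dot u.1 c1)).const_add (dot u.1 c0))).div_const 4)).smul_const u.1
    refine this.congr_deriv ?_
    simp
  have hall := (((hn.fun_sub hx).fun_add hy).prodMk (hasDerivAt_const (0 : ℝ) e2))
  refine (hall.congr_of_eventuallyEq (Eventually.of_forall fun t => ?_)).congr_deriv ?_
  · have hs : spin (axis r + t • u.2) = k t • (c0 + t • c1) := by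
      rw [spin]
      congr 1
      · simp only [k]
        congr 1
        simp [dot]
        ring
      · ext i; fin_cases i <;> simp [c0, c1]
    simp only [normalField, Prod.fst_add, Prod.snd_add, Prod.smul_fst, Prod.smul_snd, zero_add,
      hs]
    ext i
    · fin_cases i <;> simp [leftField, dot] <;> ring
    · rfl
  · ext i
    · fin_cases i <;> simp [c0, c1, spin_axis] <;> field_simp <;> ring
    · simp

/-- The tensor `A` with `2 r B(u, v) = γ(A u, v) + γ(u, A v)` at `axis r`. -/
def shear (r : ℝ) (u : Coord) : Coord :=
  (!₂[(8 * r ^ 3 / (1 + 2 * r ^ 2) ^ 2 - 2 * r / (1 + 2 * r ^ 2)) * u.2 2,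
      -u.1 2 / (1 + 2 * r ^ 2), (u.1 1 + 2 * r * u.2 0) / (1 + 2 * r ^ 2)],
    !₂[0, -u.2 2, 0])

/-- The normal vector splits into a left invariant part and `e2`. The two symmetries handle the
derivative along each, and orthogonality of the normal field handles the other terms; their sum is
the tensor `shear`. -/
theorem secondForm_axis (r : ℝ) {u : Coord} (hu : u ∈ tangentH) :
    r * secondForm (0, axis r) (normalField (0, axis r)) u u
      = metricL (0, axis r) (shear r u) u := by
  have hp : ((0, axis r) : Coord).2 1 = 0 := axis_one r
  have h1 := fderiv_metricL_normal hp (contDiff_normalField.differentiable (by norm_num) _)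
    (Eventually.of_forall fun q hq w hw => metricL_normalField q w hq hw) hu hu
  have hn : normalField (0, axis r) = (spin (axis r), 0) + (0, e2) := by
    rw [normalField, leftField_zero]; simp
  have h2 := fderiv_metricL_e2 r u u
  have h3 := fderiv_metricL_left (axis r) (spin (axis r)) u u
  rw [metricL_comm _ u (genX u.1, genX u.2)] at h2
  rw [metricL_comm _ u ((1 / 2 : ℝ) • cross (spin (axis r)) u.1, 0)] at h3
  have h4 : shear r u = (genX u.1, genX u.2)
      + r • ((1 / 2 : ℝ) • cross (spin (axis r)) u.1, (0 : R3))
      + r • fderiv ℝ normalField (0, axis r) u := by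
    have hα : 1 + 2 * r ^ 2 ≠ 0 := by positivity
    have hu' : u.2 1 = 0 := hu
    rw [fderiv_normalField_axis]
    ext i
    · fin_cases i <;> simp [shear, genX, spin_axis] <;> field_simp <;> ring
    · fin_cases i <;> simp [shear, genX, hu']
  rw [h4, secondForm, map_add, map_add, map_smul, map_smul]
  simp only [add_apply, smul_apply, smul_eq_mul]
  have h5 : fderiv ℝ metricL (0, axis r) (normalField (0, axis r)) u u
      = fderiv ℝ metricL (0, axis r) (spin (axis r), 0) u u
        + fderiv ℝ metricL (0, axis r) (0, e2) u u := by
    rw [hn, map_add]; rfl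
  rw [h5]
  linear_combination (1 / 2) * h2 + (r / 2) * h3 - r * h1

theorem metricL_shear_axis (r : ℝ) {u : Coord} (hu : u ∈ tangentH) :
    metricL (0, axis r) (shear r u) u =
      -(r * transverse r / (1 + 2 * r ^ 2) ^ 2) * (u.2 2 * u.1 0)
      + u.1 2 * (r * longitudinal r / 2 * (1 + 1 / (1 + 2 * r ^ 2)) * (u.2 0 - r * u.1 1)
        + ((longitudinal r - transverse r) / 2
          + 2 * r ^ 2 * (1 + r ^ 2) * transverse r / (1 + 2 * r ^ 2) ^ 2)
          * ((1 + 2 * r ^ 2) / 2 * u.1 1 - r * u.2 0)) := by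
  have hα : 1 + 2 * r ^ 2 ≠ 0 := by positivity
  have hl := lapse_ne_zero (axis r)
  have hsq := lapse_sq (axis r)
  have hu' : u.2 1 = 0 := hu
  simp only [dot, axis_zero, axis_one, axis_two] at hsq
  rw [metricL_apply, frame_axis, frame_axis, gram_axis]
  generalize lapse (axis r) = m at *
  generalize transverse r = s
  generalize longitudinal r = t
  simp [shear, hu']
  have hm : m ^ 2 = 1 + r ^ 2 := by linear_combination hsq
  field_simp
  ring_nf
  simp only [hm]
  ring

/-- The second fundamental form at `axis r`, with respect to `normalField`. -/
def axisForm (r : ℝ) (u : Coord) : ℝ :=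
  secondForm (0, axis r) (normalField (0, axis r)) u u

/-! ### Extending the axis formula to the origin by continuity -/

theorem continuous_axis : Continuous axis := by
  unfold axis
  refine (PiLp.continuous_toLp 2 _).comp (continuous_pi fun i => ?_)
  fin_cases i <;> simp [Pi.single, Function.update] <;> fun_prop

theorem continuous_axisForm (u : Coord) : Continuous fun r => axisForm r u := by
  have hp : Continuous fun r : ℝ => ((0, axis r) : Coord) := continuous_const.prodMk continuous_axis
  have hn : Continuous fun r : ℝ => normalField (0, axis r) := contDiff_normalField.continuous.comp hp
  have hD : Continuous fun r : ℝ => fderiv ℝ metricL (0, axis r) := continuous_fderiv_metricL.comp hp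
  have hu : Continuous fun _ : ℝ => u := continuous_const
  unfold axisForm secondForm
  exact continuous_const.mul (((((hD.clm_apply hn).clm_apply hu).clm_apply hu).sub
    (((hD.clm_apply hu).clm_apply hn).clm_apply hu)).sub
    (((hD.clm_apply hu).clm_apply hn).clm_apply hu))

theorem continuous_transverse : Continuous transverse :=
  (contDiff_gram _ _).continuous.comp continuous_axis

theorem continuous_longitudinal : Continuous longitudinal :=
  (contDiff_gram _ _).continuous.comp continuous_axis

/-- An identity between continuous functions that holds for `r > 0` holds for `r ≥ 0`. -/
theorem eq_of_eq_on_pos {f g : ℝ → ℝ} (hf : Continuous f) (hg : Continuous g)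
    (h : ∀ r, 0 < r → f r = g r) {r : ℝ} (hr : 0 ≤ r) : f r = g r := by
  have hcl : IsClosed {r | f r = g r} := isClosed_eq hf hg
  have hsub : Ioi (0 : ℝ) ⊆ {r | f r = g r} := fun r hr => h r hr
  have := closure_minimal hsub hcl
  rw [closure_Ioi] at this
  exact this hr

/-- The vector with components `(a₁, σ₃) = (1, 1)`. -/
def testVec₁ : Coord := (EuclideanSpace.single 2 1, EuclideanSpace.single 0 1)

/-- The vector with components `(σ₂, σ₃) = (1, 1)`. -/
def testVec₂ : Coord := (!₂[0, 1, 1], 0)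

theorem axisForm_of_pos {r : ℝ} (hr : 0 < r) {u : Coord} (hu : u ∈ tangentH) :
    axisForm r u = -(transverse r / (1 + 2 * r ^ 2) ^ 2) * (u.2 2 * u.1 0)
      + u.1 2 * (longitudinal r / 2 * (1 + 1 / (1 + 2 * r ^ 2)) * (u.2 0 - r * u.1 1)
        + ((longitudinal r - transverse r) / 2
          + 2 * r ^ 2 * (1 + r ^ 2) * transverse r / (1 + 2 * r ^ 2) ^ 2) / r
          * ((1 + 2 * r ^ 2) / 2 * u.1 1 - r * u.2 0)) := by
  have h := secondForm_axis r hu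
  rw [metricL_shear_axis r hu] at h
  apply mul_left_cancel₀ hr.ne'
  rw [axisForm, h]
  field_simp

theorem axisForm_testVec₁_of_pos {r : ℝ} (hr : 0 < r) :
    axisForm r testVec₁ = longitudinal r / 2 * (1 + 1 / (1 + 2 * r ^ 2))
        - ((longitudinal r - transverse r) / 2
          + 2 * r ^ 2 * (1 + r ^ 2) * transverse r / (1 + 2 * r ^ 2) ^ 2) := by
  rw [axisForm_of_pos hr (by simp [mem_tangentH, testVec₁])]
  simp [testVec₁]
  field_simp
  ring

theorem axisForm_testVec₂_of_pos {r : ℝ} (hr : 0 < r) :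
    r * axisForm r testVec₂ = -r ^ 2 * (longitudinal r / 2 * (1 + 1 / (1 + 2 * r ^ 2)))
        + ((longitudinal r - transverse r) / 2
          + 2 * r ^ 2 * (1 + r ^ 2) * transverse r / (1 + 2 * r ^ 2) ^ 2) * ((1 + 2 * r ^ 2) / 2) := by
  rw [axisForm_of_pos hr (by simp [mem_tangentH, testVec₂])]
  simp [testVec₂]
  field_simp

/-- The explicit coefficients contain a division by `r`. Written as values of the form on two test
vectors they are continuous, so the identity extends from `r > 0` to `r = 0`. -/
theorem axisForm_eq {r : ℝ} (hr : 0 ≤ r) {u : Coord} (hu : u ∈ tangentH) :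
    axisForm r u = -(transverse r / (1 + 2 * r ^ 2) ^ 2) * (u.2 2 * u.1 0)
      + axisForm r testVec₁ * (u.2 0 * u.1 2) + axisForm r testVec₂ * (u.1 1 * u.1 2) := by
  have c0 := continuous_axisForm u
  have c1 := continuous_axisForm testVec₁
  have c2 := continuous_axisForm testVec₂
  have c3 := continuous_transverse
  have hα : ∀ r : ℝ, (1 + 2 * r ^ 2) ^ 2 ≠ 0 := fun r => by positivity
  refine eq_of_eq_on_pos (f := fun r => axisForm r u) c0
    (g := fun r => -(transverse r / (1 + 2 * r ^ 2) ^ 2) * (u.2 2 * u.1 0)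
      + axisForm r testVec₁ * (u.2 0 * u.1 2) + axisForm r testVec₂ * (u.1 1 * u.1 2))
    (by fun_prop (disch := exact hα _)) (fun r hr => ?_) hr
  have h2 := axisForm_testVec₂_of_pos hr
  apply mul_left_cancel₀ hr.ne'
  beta_reduce
  rw [axisForm_of_pos hr hu, axisForm_testVec₁_of_pos hr]
  field_simp at h2 ⊢
  linear_combination (-u.1 1 * u.1 2 * (1 + 2 * r ^ 2)) * h2

/-- In this combination the term divided by `r` cancels. The right side is positive, so the two
coefficients cannot vanish together. -/
theorem axisForm_testVec_relation {r : ℝ} (hr : 0 ≤ r) :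
    (1 + 2 * r ^ 2) * axisForm r testVec₁ + 2 * r * axisForm r testVec₂
      = longitudinal r / 2 * (1 + 1 / (1 + 2 * r ^ 2)) := by
  have c1 := continuous_axisForm testVec₁
  have c2 := continuous_axisForm testVec₂
  have c3 := continuous_longitudinal
  have hα : ∀ r : ℝ, (1 + 2 * r ^ 2) ≠ 0 := fun r => by positivity
  refine eq_of_eq_on_pos (f := fun r => (1 + 2 * r ^ 2) * axisForm r testVec₁
      + 2 * r * axisForm r testVec₂) (by fun_prop)
    (g := fun r => longitudinal r / 2 * (1 + 1 / (1 + 2 * r ^ 2)))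
    (by fun_prop (disch := exact hα _)) (fun r hr => ?_) hr
  have h2 := axisForm_testVec₂_of_pos hr
  rw [mul_assoc, h2, axisForm_testVec₁_of_pos hr]
  field_simp
  ring

/-! ### Reduction to the third axis and the normal form of `B` -/

theorem fderiv_metricL_rotY (θ : ℝ) (p w u v : Coord) :
    fderiv ℝ metricL ((rotY θ).prodMap (rotY θ) p) ((rotY θ).prodMap (rotY θ) w)
      ((rotY θ).prodMap (rotY θ) u) ((rotY θ).prodMap (rotY θ) v)
      = fderiv ℝ metricL p w u v := by
  set R := (rotY θ).prodMap (rotY θ)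
  have h1 := hasDerivAt_metricL_curve (hasDerivAt_line p w) (hasDerivAt_const (0 : ℝ) u)
    (hasDerivAt_const (0 : ℝ) v)
  have h2 := hasDerivAt_metricL_curve (hasDerivAt_line (R p) (R w))
    (hasDerivAt_const (0 : ℝ) (R u)) (hasDerivAt_const (0 : ℝ) (R v))
  simp only [← map_smul, ← map_add, R, metricL_rotY] at h2
  have h3 := h2.unique h1
  simpa [R] using h3

theorem secondForm_rotY (θ : ℝ) (p n u v : Coord) :
    secondForm ((rotY θ).prodMap (rotY θ) p) ((rotY θ).prodMap (rotY θ) n)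
      ((rotY θ).prodMap (rotY θ) u) ((rotY θ).prodMap (rotY θ) v) = secondForm p n u v := by
  simp only [secondForm, fderiv_metricL_rotY]

theorem normalField_rotY (θ : ℝ) (v : R3) :
    normalField (0, rotY θ v) = (rotY θ).prodMap (rotY θ) (normalField (0, v)) := by
  have h := isRotation_rotY θ
  have hs : spin (rotY θ v) = rotY θ (spin v) := by
    rw [spin, spin, h.1, map_smul, ← h.2, rotY_e2]
  simp only [normalField, leftField_zero, hs, LinearMap.prodMap_apply, rotY_e2]

theorem finrank_tangentH : finrank ℝ tangentH = 5 := by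
  set f : Dual ℝ Coord := (EuclideanSpace.proj (1 : Fin 3) : R3 →L[ℝ] ℝ).toLinearMap ∘ₗ
    LinearMap.snd ℝ R3 R3
  have hk : LinearMap.ker f = tangentH := by
    ext u
    simp [f, mem_tangentH]
  have hf : f ≠ 0 := fun h => by
    have := LinearMap.congr_fun h ((0, e2) : Coord)
    simp [f] at this
  have h := Module.Dual.finrank_ker_add_one_of_ne_zero hf
  rw [hk, finrank_prod, finrank_euclideanSpace_fin] at h
  omega

/-- At every point of the hypersurface the second fundamental form has signature `(2, 2)` and a
one-dimensional kernel. -/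
theorem exists_normal_form {U : SU2} {v : R3} (hv : v 1 = 0) {N : Coord → Coord}
    (hN : IsNormalFieldAt U (0, v) N) :
    ∃ Φ : tangentH ≃ₗ[ℝ] (Fin 5 → ℝ), ∀ u : tangentH,
      formB U (0, v) N u u = Φ u 0 * Φ u 1 + Φ u 2 * Φ u 3 := by
  obtain ⟨θ, r, hr, rfl⟩ := exists_rotY_axis v hv
  obtain ⟨c, hc, hNc⟩ := exists_smul_normalField (p := (0, rotY θ (axis r))) hv hN
  set f := -(transverse r / (1 + 2 * r ^ 2) ^ 2) with hf
  set g := axisForm r testVec₁ with hg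
  set h := axisForm r testVec₂ with hh
  have hf0 : f ≠ 0 := by
    have := transverse_pos r
    rw [hf]
    exact neg_ne_zero.2 (by positivity)
  have hgh : g ^ 2 + h ^ 2 ≠ 0 := fun h0 => by
    have h1 := axisForm_testVec_relation hr
    have hg0 : g = 0 := by nlinarith [sq_nonneg g, sq_nonneg h]
    have hh0 : h = 0 := by nlinarith [sq_nonneg g, sq_nonneg h]
    rw [← hg, ← hh, hg0, hh0] at h1
    have := longitudinal_pos r
    have h2 : 0 < longitudinal r / 2 * (1 + 1 / (1 + 2 * r ^ 2)) := by positivity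
    linarith
  set R := (rotY (-θ)).prodMap (rotY (-θ)) with hR
  have hinv : ∀ u : Coord, (rotY θ).prodMap (rotY θ) (R u) = u := fun u => by
    have := Real.sin_sq_add_cos_sq θ
    ext i <;> fin_cases i <;> simp [hR]
    · linear_combination u.1 0 * this
    · linear_combination u.1 2 * this
    · linear_combination u.2 0 * this
    · linear_combination u.2 2 * this
  have hRt : ∀ u : tangentH, (R u).2 1 = 0 := fun u => by
    have : (u : Coord).2 1 = 0 := u.2
    simp [hR, this]
  -- The first four coordinates are the linear factors of `c (f dλ₃ σ₁ + σ₃ (g dλ₁ + h σ₂))`. The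
  -- fifth completes `g dλ₁ + h σ₂` to an invertible pair of determinant `g² + h²`; the kernel of
  -- `B` is the line along it.
  set Ψ : tangentH →ₗ[ℝ] (Fin 5 → ℝ) :=
    { toFun := fun u => ![c * (R u).1 0, f * (R u).2 2, c * (R u).1 2,
        g * (R u).2 0 + h * (R u).1 1, -h * (R u).2 0 + g * (R u).1 1]
      map_add' := fun u w => by
        ext i; fin_cases i <;> simp [-LinearMap.prodMap_apply] <;> ring
      map_smul' := fun a u => by
        ext i; fin_cases i <;> simp [-LinearMap.prodMap_apply] <;> ring } with hΨ
  have hinj : Function.Injective Ψ := by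
    rw [← LinearMap.ker_eq_bot, LinearMap.ker_eq_bot']
    intro u hu
    have e0 := congrFun hu 0
    have e1 := congrFun hu 1
    have e2 := congrFun hu 2
    have e3 := congrFun hu 3
    have e4 := congrFun hu 4
    simp [-LinearMap.prodMap_apply, hΨ, hc, hf0] at e0 e1 e2 e3 e4
    have e5 : (R u).2 0 = 0 := by
      apply mul_left_cancel₀ hgh
      linear_combination g * e3 - h * e4
    have e6 : (R u).1 1 = 0 := by
      apply mul_left_cancel₀ hgh
      linear_combination h * e3 + g * e4
    have e7 : R u = 0 := by
      have := hRt u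
      refine Prod.ext (PiLp.ext fun i => ?_) (PiLp.ext fun i => ?_) <;> fin_cases i
      exacts [e0, e6, e2, e5, this, e1]
    have e8 := hinv u
    rw [e7, map_zero] at e8
    exact Subtype.ext e8.symm
  refine ⟨LinearMap.linearEquivOfInjective Ψ hinj (by simp [finrank_tangentH]), fun u => ?_⟩
  rw [formB_eq_secondForm hv hN u.2 u.2, hNc, secondForm_smul_left]
  have hp : ((0, rotY θ (axis r)) : Coord) = (rotY θ).prodMap (rotY θ) (0, axis r) := by simp
  have e : secondForm (0, rotY θ (axis r)) (normalField (0, rotY θ (axis r))) u u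
      = axisForm r (R u) := by
    rw [normalField_rotY, hp, ← hinv u, secondForm_rotY, hinv]
    rfl
  rw [e, axisForm_eq hr (hRt u)]
  simp [-LinearMap.prodMap_apply, hΨ]
  ring

/-- Polarization: the form vanishes on each of the two vectors, so its value on their sum, a
negative multiple of `transverse r`, is the mixed coefficient up to the scale of `N`. -/
theorem coeffF2_ne_zero {U : SU2} {r : ℝ} (hr : 0 ≤ r) {N : Coord → Coord}
    (hN : IsNormalFieldAt U (0, axis r) N) : coeffF2 U (0, axis r) N ≠ 0 := by
  have hv : ((0, axis r) : Coord).2 1 = 0 := axis_one r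
  obtain ⟨c, hc, hNc⟩ := exists_smul_normalField hv hN
  set x : Coord := (0, EuclideanSpace.single 2 1)
  set y : Coord := (EuclideanSpace.single 0 1, 0)
  have hx : x ∈ tangentH := by simp [mem_tangentH, x]
  have hy : y ∈ tangentH := by simp [mem_tangentH, y]
  have h1 := axisForm_eq hr hx
  have h2 := axisForm_eq hr hy
  have h3 := axisForm_eq hr (tangentH.add_mem hx hy)
  have h4 := secondForm_add_self (0, axis r) (normalField (0, axis r)) x y
  simp only [axisForm] at h1 h2 h3
  simp [x, y] at h1 h2 h3
  have hxy : x + y = (EuclideanSpace.single 0 1, EuclideanSpace.single 2 1) := by simp [x, y]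
  change secondForm (0, axis r) (normalField (0, axis r)) x x = 0 at h1
  change secondForm (0, axis r) (normalField (0, axis r)) y y = 0 at h2
  rw [hxy, h3, h1, h2] at h4
  rw [coeffF2, formB_eq_secondForm hv hN hx hy, formB_eq_secondForm hv hN hy hx,
    secondForm_comm _ _ y x, hNc, secondForm_smul_left, ← two_mul, mul_left_comm]
  have := transverse_pos r
  refine mul_ne_zero hc fun h => ?_
  have h5 : 0 < transverse r / (1 + 2 * r ^ 2) ^ 2 := by positivity
  linarith

/-! ### The cone over the suspension of a two-torus -/

/-- The cone `|a| = |b|` in `ℂ × ℂ × ℝ`. -/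
def torusCone : Set (ℂ × ℂ × ℝ) := {y | ‖y.1‖ = ‖y.2.1‖}

theorem isClosed_torusCone : IsClosed torusCone :=
  isClosed_eq (by fun_prop) (by fun_prop)

theorem smul_mem_torusCone {y : ℂ × ℂ × ℝ} (hy : y ∈ torusCone) (s : ℝ) : s • y ∈ torusCone := by
  have hy' : ‖y.1‖ = ‖y.2.1‖ := hy
  simp [torusCone, hy']

/-- Polar coordinates on `torusCone`. -/
def torusConeParam (q : ℝ × ℝ × ℝ × ℝ) : ℂ × ℂ × ℝ :=
  ((q.1 : ℂ) * Complex.exp ((q.2.1 : ℂ) * Complex.I),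
    (q.1 : ℂ) * Complex.exp ((q.2.2.1 : ℂ) * Complex.I), q.2.2.2)

theorem contDiff_torusConeParam : ContDiff ℝ 1 torusConeParam := by
  have h : ContDiff ℝ 1 fun r : ℝ => (r : ℂ) := Complex.ofRealCLM.contDiff
  have h1 : ContDiff ℝ 1 fun q : ℝ × ℝ × ℝ × ℝ => (q.1 : ℂ) := h.comp contDiff_fst
  have h2 : ContDiff ℝ 1 fun q : ℝ × ℝ × ℝ × ℝ => (q.2.1 : ℂ) :=
    h.comp (contDiff_fst.comp contDiff_snd)
  have h3 : ContDiff ℝ 1 fun q : ℝ × ℝ × ℝ × ℝ => (q.2.2.1 : ℂ) :=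
    h.comp (contDiff_fst.comp (contDiff_snd.comp contDiff_snd))
  unfold torusConeParam
  exact (h1.mul (h2.mul contDiff_const).cexp).prodMk
    ((h1.mul (h3.mul contDiff_const).cexp).prodMk
      (contDiff_snd.comp (contDiff_snd.comp contDiff_snd)))

theorem torusCone_subset_range : torusCone ⊆ range torusConeParam := fun y hy => by
  have hy' : ‖y.1‖ = ‖y.2.1‖ := hy
  refine ⟨(‖y.1‖, y.1.arg, y.2.1.arg, y.2.2), ?_⟩
  have h1 := Complex.norm_mul_exp_arg_mul_I y.1
  have h2 := Complex.norm_mul_exp_arg_mul_I y.2.1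
  rw [torusConeParam]
  dsimp only
  rw [h1, hy', h2]

section Embedding
variable {E : Type*} [NormedAddCommGroup E] [NormedSpace ℝ E]

theorem dimH_image_torusCone [FiniteDimensional ℝ E] (J : (ℂ × ℂ × ℝ) →ₗ[ℝ] E) (hJ : Function.Injective J) :
    dimH (J '' torusCone) = 4 := by
  -- Upper bound: polar coordinates cover the cone by a `C¹` image of `ℝ⁴`. Lower bound: forgetting
  -- the imaginary part of `b` is Lipschitz and maps the cone onto a set with interior in a
  -- four-dimensional space.
  apply le_antisymm
  · have hc : ContDiff ℝ 1 (J.toContinuousLinearMap ∘ torusConeParam) :=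
      J.toContinuousLinearMap.contDiff.comp contDiff_torusConeParam
    have h := hc.dimH_range_le
    simp only [finrank_prod, finrank_self] at h
    refine (dimH_mono ?_).trans (h.trans (by norm_num))
    rw [range_comp]
    exact image_mono torusCone_subset_range
  · obtain ⟨g, hg⟩ := J.exists_leftInverse_of_injective (LinearMap.ker_eq_bot.2 hJ)
    set k : (ℂ × ℂ × ℝ) →ₗ[ℝ] (ℂ × ℝ × ℝ) :=
      LinearMap.prodMap LinearMap.id (LinearMap.prodMap Complex.reLm LinearMap.id)
    set f := (k ∘ₗ g).toContinuousLinearMap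
    have hsub : {y : ℂ × ℝ × ℝ | |y.2.1| < ‖y.1‖} ⊆ f '' (J '' torusCone) := by
      intro y hy
      have hy' : |y.2.1| < ‖y.1‖ := hy
      have hpos : 0 ≤ ‖y.1‖ ^ 2 - y.2.1 ^ 2 := by
        rw [← sq_abs y.2.1]
        nlinarith [abs_nonneg y.2.1]
      refine ⟨J (y.1, ⟨y.2.1, √(‖y.1‖ ^ 2 - y.2.1 ^ 2)⟩, y.2.2), ⟨_, ?_, rfl⟩, ?_⟩
      · change ‖y.1‖ = ‖(⟨y.2.1, √(‖y.1‖ ^ 2 - y.2.1 ^ 2)⟩ : ℂ)‖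
        have h := Complex.normSq_eq_norm_sq (⟨y.2.1, √(‖y.1‖ ^ 2 - y.2.1 ^ 2)⟩ : ℂ)
        rw [Complex.normSq_mk, Real.mul_self_sqrt hpos] at h
        rw [← sq_eq_sq₀ (norm_nonneg _) (norm_nonneg _), ← h]
        ring
      · change k (g (J _)) = y
        have := LinearMap.congr_fun hg (y.1, ⟨y.2.1, √(‖y.1‖ ^ 2 - y.2.1 ^ 2)⟩, y.2.2)
        simp only [LinearMap.comp_apply, LinearMap.id_apply] at this
        rw [this]
        simp [k]
    have hopen : IsOpen {y : ℂ × ℝ × ℝ | |y.2.1| < ‖y.1‖} :=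
      isOpen_lt (by fun_prop) (by fun_prop)
    have hint : (interior (f '' (J '' torusCone))).Nonempty :=
      ⟨(1, 0, 0), interior_mono hsub (by rw [hopen.interior_eq]; simp)⟩
    have h := Real.dimH_of_nonempty_interior hint
    have h' := f.lipschitz.dimH_image_le (J '' torusCone)
    rw [h] at h'
    simpa [finrank_prod] using h'

/-- A section of the cone `torusCone` over the cylinder on the torus. -/
def coneSection (q : (Circle × Circle) × unitInterval) : ℂ × ℂ × ℝ :=
  ((1 - |2 * (q.2 : ℝ) - 1|) • (q.1.1 : ℂ), (1 - |2 * (q.2 : ℝ) - 1|) • (q.1.2 : ℂ), 2 * (q.2 : ℝ) - 1)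

theorem continuous_coneSection : Continuous coneSection := by
  unfold coneSection
  fun_prop

theorem abs_height_le_one (t : unitInterval) : |2 * (t : ℝ) - 1| ≤ 1 :=
  abs_le.2 ⟨by linarith [t.2.1], by linarith [t.2.2]⟩

theorem norm_coneSection_fst (q : (Circle × Circle) × unitInterval) :
    ‖(coneSection q).1‖ = 1 - |2 * (q.2 : ℝ) - 1| := by
  rw [coneSection, norm_smul, Circle.norm_coe, mul_one, Real.norm_eq_abs,
    abs_of_nonneg (by linarith [abs_height_le_one q.2])]

theorem coneSection_mem (q : (Circle × Circle) × unitInterval) : coneSection q ∈ torusCone := by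
  change ‖_ • (q.1.1 : ℂ)‖ = ‖_ • (q.1.2 : ℂ)‖
  rw [norm_smul, norm_smul, Circle.norm_coe, Circle.norm_coe]

theorem coneSection_ne_zero (q : (Circle × Circle) × unitInterval) : coneSection q ≠ 0 := fun h => by
  have h1 := norm_coneSection_fst q
  have h2 : 2 * (q.2 : ℝ) - 1 = 0 := congrArg (fun y => y.2.2) h
  rw [h, h2] at h1
  simp at h1

theorem coneSection_eq_of_rel {a b : (Circle × Circle) × unitInterval}
    (h : suspensionRel (Circle × Circle) a b) : coneSection a = coneSection b := by
  rcases h with ⟨h1, h2⟩ | ⟨h1, h2⟩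
  · simp [coneSection, h1, h2]
  · simp [coneSection, h1, h2]
    norm_num

/-- On the section, the modulus of the first component and the absolute height add up to 1, so each
ray meets it once. The torus parameters are lost only at height ±1, the two ends that the suspension
collapses. -/
theorem eq_of_coneSection_eq_smul {a b : (Circle × Circle) × unitInterval} {k : ℝ} (hk : 0 < k)
    (h : coneSection a = k • coneSection b) :
    (Quot.mk _ a : TopSuspension (Circle × Circle)) = Quot.mk _ b := by
  have h1 : ‖(coneSection a).1‖ = k * ‖(coneSection b).1‖ := by
    rw [h, Prod.smul_fst, norm_smul, Real.norm_eq_abs, abs_of_pos hk]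
  have h2 : 2 * (a.2 : ℝ) - 1 = k * (2 * (b.2 : ℝ) - 1) := congrArg (fun y => y.2.2) h
  have h3 : |2 * (a.2 : ℝ) - 1| = k * |2 * (b.2 : ℝ) - 1| := by rw [h2, abs_mul, abs_of_pos hk]
  rw [norm_coneSection_fst, norm_coneSection_fst, h3] at h1
  obtain rfl : k = 1 := by linarith
  rw [one_smul] at h
  have ht : a.2 = b.2 := Subtype.ext (by linarith)
  by_cases h0 : 1 - |2 * (b.2 : ℝ) - 1| = 0
  · apply Quot.sound
    rcases abs_eq (zero_le_one' ℝ) |>.1 (sub_eq_zero.1 h0).symm with h4 | h4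
    · have : b.2 = 1 := Subtype.ext (show (b.2 : ℝ) = 1 by linarith)
      exact Or.inr ⟨ht.trans this, this⟩
    · have : b.2 = 0 := Subtype.ext (show (b.2 : ℝ) = 0 by linarith)
      exact Or.inl ⟨ht.trans this, this⟩
  · have e1 : (1 - |2 * (a.2 : ℝ) - 1|) • (a.1.1 : ℂ) = (1 - |2 * (b.2 : ℝ) - 1|) • (b.1.1 : ℂ) :=
      congrArg (fun y => y.1) h
    have e2 : (1 - |2 * (a.2 : ℝ) - 1|) • (a.1.2 : ℂ) = (1 - |2 * (b.2 : ℝ) - 1|) • (b.1.2 : ℂ) :=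
      congrArg (fun y => y.2.1) h
    rw [ht] at e1 e2
    exact congrArg _ (Prod.ext (Prod.ext (Circle.ext (smul_right_injective ℂ h0 e1))
      (Circle.ext (smul_right_injective ℂ h0 e2))) ht)

theorem exists_circle_smul (z : ℂ) : ∃ e : Circle, z = ‖z‖ • (e : ℂ) :=
  ⟨Circle.exp z.arg, by
    rw [Circle.coe_exp, Complex.real_smul, Complex.norm_mul_exp_arg_mul_I]⟩

theorem exists_coneSection {y : ℂ × ℂ × ℝ} (hy : y ∈ torusCone) (h0 : y ≠ 0) :
    ∃ q, ∃ m : ℝ, 0 < m ∧ y = m • coneSection q := by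
  have hy' : ‖y.1‖ = ‖y.2.1‖ := hy
  set m := ‖y.1‖ + |y.2.2| with hm
  have hpos : 0 < m := by
    refine lt_of_le_of_ne (by positivity) fun h => h0 ?_
    have h1 : ‖y.1‖ = 0 := by linarith [norm_nonneg y.1, abs_nonneg y.2.2]
    have h2 : |y.2.2| = 0 := by linarith [norm_nonneg y.1, abs_nonneg y.2.2]
    exact Prod.ext (norm_eq_zero.1 h1) (Prod.ext (norm_eq_zero.1 (hy' ▸ h1)) (abs_eq_zero.1 h2))
  obtain ⟨e, he⟩ := exists_circle_smul y.1
  obtain ⟨f, hf⟩ := exists_circle_smul y.2.1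
  have hw : |y.2.2 / m| ≤ 1 := by
    rw [abs_div, abs_of_pos hpos, div_le_one hpos]
    linarith [norm_nonneg y.1]
  have hw' := abs_le.1 hw
  set t : unitInterval := ⟨(y.2.2 / m + 1) / 2, by linarith, by linarith⟩ with ht
  have h1 : 2 * (t : ℝ) - 1 = y.2.2 / m := by simp only [ht]; ring
  have h2 : m * (1 - |2 * (t : ℝ) - 1|) = ‖y.1‖ := by
    rw [h1, abs_div, abs_of_pos hpos, mul_sub, mul_div_cancel₀ _ hpos.ne']
    linarith
  refine ⟨((e, f), t), m, hpos, Prod.ext ?_ (Prod.ext ?_ ?_)⟩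
  · change y.1 = m • ((1 - |2 * (t : ℝ) - 1|) • (e : ℂ))
    rw [smul_smul, h2, ← he]
  · change y.2.1 = m • ((1 - |2 * (t : ℝ) - 1|) • (f : ℂ))
    rw [smul_smul, h2, hy', ← hf]
  · change y.2.2 = m * (2 * (t : ℝ) - 1)
    rw [h1, mul_div_cancel₀ _ hpos.ne']

/-- The link of a linear image of `torusCone`, with respect to any positive function of degree
two, is the suspension of the two-torus. -/
theorem nonempty_homeomorph_suspension (J : (ℂ × ℂ × ℝ) →ₗ[ℝ] E) (hJ : Function.Injective J)
    {G : E → ℝ} (hG : Continuous G) (hG2 : ∀ (s : ℝ) u, G (s • u) = s ^ 2 * G u)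
    (hG0 : ∀ u, u ≠ 0 → 0 < G u) :
    Nonempty ({u | u ∈ J '' torusCone ∧ G u = 1} ≃ₜ TopSuspension (Circle × Circle)) := by
  have hJc : Continuous J := J.continuous_of_finiteDimensional
  have hpos : ∀ q, 0 < G (J (coneSection q)) := fun q =>
    hG0 _ fun h => coneSection_ne_zero q (hJ (h.trans (map_zero J).symm))
  -- Radial projection to `G = 1`. It descends to a continuous bijection from the compact suspension
  -- to a Hausdorff space, hence a homeomorphism.
  set s : (Circle × Circle) × unitInterval → ℝ := fun q => (√(G (J (coneSection q))))⁻¹ with hs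
  have hs0 : ∀ q, 0 < s q := fun q => inv_pos.2 (Real.sqrt_pos.2 (hpos q))
  have hsc : Continuous s := by
    refine Continuous.inv₀ ?_ fun q => (Real.sqrt_pos.2 (hpos q)).ne'
    exact (hG.comp (hJc.comp continuous_coneSection)).sqrt
  have hmem : ∀ q, s q • J (coneSection q) ∈ {u | u ∈ J '' torusCone ∧ G u = 1} := fun q => by
    refine ⟨⟨s q • coneSection q, smul_mem_torusCone (coneSection_mem q) _, map_smul _ _ _⟩, ?_⟩
    rw [hG2, hs, inv_pow, Real.sq_sqrt (hpos q).le, inv_mul_cancel₀ (hpos q).ne']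
  set f : TopSuspension (Circle × Circle) → {u | u ∈ J '' torusCone ∧ G u = 1} :=
    Quot.lift (fun q => ⟨s q • J (coneSection q), hmem q⟩) fun a b h => by
      simp only [hs, coneSection_eq_of_rel h] with hf
  have hfc : Continuous f := continuous_quot_lift _
    ((hsc.smul (hJc.comp continuous_coneSection)).subtype_mk hmem)
  have hbij : Function.Bijective f := by
    constructor
    · rintro ⟨a⟩ ⟨b⟩ h
      have h1 : s a • J (coneSection a) = s b • J (coneSection b) := congrArg Subtype.val h
      rw [← map_smul, ← map_smul] at h1
      have h2 := hJ h1
      refine eq_of_coneSection_eq_smul (k := (s a)⁻¹ * s b) (mul_pos (inv_pos.2 (hs0 a)) (hs0 b)) ?_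
      rw [mul_smul, ← h2, inv_smul_smul₀ (hs0 a).ne']
    · rintro ⟨u, ⟨y, hy, rfl⟩, hu⟩
      have hy0 : y ≠ 0 := fun h => by
        have := hG2 0 (J y)
        rw [zero_smul, zero_pow two_ne_zero, zero_mul] at this
        rw [h, map_zero, this] at hu
        exact zero_ne_one hu
      obtain ⟨q, m, hm, rfl⟩ := exists_coneSection hy hy0
      refine ⟨Quot.mk _ q, Subtype.ext ?_⟩
      change s q • J (coneSection q) = J (m • coneSection q)
      rw [map_smul, hG2] at hu
      rw [map_smul]
      congr 1
      simp only [hs]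
      rw [show G (J (coneSection q)) = m⁻¹ ^ 2 by
        rw [inv_pow]; exact eq_inv_of_mul_eq_one_right hu, Real.sqrt_sq (inv_pos.2 hm).le, inv_inv]
  exact ⟨(hfc.homeoOfEquivCompactToT2 (f := Equiv.ofBijective f hbij)).symm⟩

end Embedding

/-! ### The null cone and its link -/

/-- Each product of coordinates in the normal form becomes a difference of squares under `(x + y)(x
- y)`; the real and imaginary parts collect the two positive and the two negative directions. -/
theorem exists_torusCone_form {U : SU2} {v : R3} (hv : v 1 = 0) {N : Coord → Coord}
    (hN : IsNormalFieldAt U (0, v) N) :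
    ∃ J : (ℂ × ℂ × ℝ) →ₗ[ℝ] Coord, Function.Injective J ∧ LinearMap.range J = tangentH ∧
      ∀ y, formB U (0, v) N (J y) (J y) = ‖y.1‖ ^ 2 - ‖y.2.1‖ ^ 2 := by
  obtain ⟨Φ, hΦ⟩ := exists_normal_form hv hN
  set A : (ℂ × ℂ × ℝ) →ₗ[ℝ] (Fin 5 → ℝ) :=
    { toFun := fun y => ![y.1.re + y.2.1.re, y.1.re - y.2.1.re, y.1.im + y.2.1.im,
        y.1.im - y.2.1.im, y.2.2]
      map_add' := fun u w => by ext i; fin_cases i <;> simp <;> ring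
      map_smul' := fun a u => by ext i; fin_cases i <;> simp <;> ring } with hA
  have hinj : Function.Injective A := by
    rw [← LinearMap.ker_eq_bot, LinearMap.ker_eq_bot']
    intro y hy
    have e0 := congrFun hy 0
    have e1 := congrFun hy 1
    have e2 := congrFun hy 2
    have e3 := congrFun hy 3
    have e4 := congrFun hy 4
    simp [hA] at e0 e1 e2 e3 e4
    refine Prod.ext (Complex.ext ?_ ?_) (Prod.ext (Complex.ext ?_ ?_) e4) <;> simp <;> linarith
  set A' := LinearMap.linearEquivOfInjective A hinj (by simp [finrank_prod]) with hA'
  refine ⟨tangentH.subtype ∘ₗ (A'.trans Φ.symm).toLinearMap,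
    (Subtype.val_injective).comp (A'.trans Φ.symm).injective, ?_, fun y => ?_⟩
  · rw [LinearMap.range_comp, LinearEquiv.range, Submodule.map_top, Submodule.range_subtype]
  · have h := hΦ ((A'.trans Φ.symm) y)
    have e : Φ ((A'.trans Φ.symm) y) = A y := by simp [hA']
    rw [e] at h
    refine h.trans ?_
    rw [← Complex.normSq_eq_norm_sq, ← Complex.normSq_eq_norm_sq, Complex.normSq_apply,
      Complex.normSq_apply]
    simp [hA]
    ring

theorem nullCone_eq_image {U : SU2} {p : Coord} {N : Coord → Coord} {J : (ℂ × ℂ × ℝ) →ₗ[ℝ] Coord}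
    (hJ : LinearMap.range J = tangentH)
    (hB : ∀ y, formB U p N (J y) (J y) = ‖y.1‖ ^ 2 - ‖y.2.1‖ ^ 2) :
    nullCone U p N = J '' torusCone := by
  have key : ∀ y, formB U p N (J y) (J y) = 0 ↔ y ∈ torusCone := fun y => by
    rw [hB, sub_eq_zero, sq_eq_sq₀ (norm_nonneg _) (norm_nonneg _)]
    rfl
  ext u
  constructor
  · rintro ⟨hu, h⟩
    rw [← hJ] at hu
    obtain ⟨y, rfl⟩ := hu
    exact ⟨y, (key y).1 h, rfl⟩
  · rintro ⟨y, hy, rfl⟩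
    exact ⟨hJ ▸ LinearMap.mem_range_self J y, (key y).2 hy⟩

variable {U : SU2} {v : R3} {N : Coord → Coord}

theorem smul_mem_nullCone (hv : v 1 = 0) (hN : IsNormalFieldAt U (0, v) N) {u : Coord}
    (hu : u ∈ nullCone U (0, v) N) (r : ℝ) : r • u ∈ nullCone U (0, v) N := by
  obtain ⟨J, -, hJ, hB⟩ := exists_torusCone_form hv hN
  rw [nullCone_eq_image hJ hB] at hu ⊢
  obtain ⟨y, hy, rfl⟩ := hu
  exact ⟨r • y, smul_mem_torusCone hy r, map_smul _ _ _⟩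

theorem isClosed_nullCone (hv : v 1 = 0) (hN : IsNormalFieldAt U (0, v) N) :
    IsClosed (nullCone U (0, v) N) := by
  obtain ⟨J, hinj, hJ, hB⟩ := exists_torusCone_form hv hN
  rw [nullCone_eq_image hJ hB]
  exact (LinearMap.isClosedEmbedding_of_injective (LinearMap.ker_eq_bot.2 hinj)).isClosedMap _
    isClosed_torusCone

theorem dimH_nullCone (hv : v 1 = 0) (hN : IsNormalFieldAt U (0, v) N) :
    dimH (nullCone U (0, v) N) = 4 := by
  obtain ⟨J, hinj, hJ, hB⟩ := exists_torusCone_form hv hN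
  rw [nullCone_eq_image hJ hB, dimH_image_torusCone J hinj]

theorem nonempty_nullLink_homeomorph (hv : v 1 = 0) (hN : IsNormalFieldAt U (0, v) N) :
    Nonempty (nullLink U (0, v) N ≃ₜ TopSuspension (Circle × Circle)) := by
  obtain ⟨J, hinj, hJ, hB⟩ := exists_torusCone_form hv hN
  have h := nonempty_homeomorph_suspension J hinj (G := fun u => metricL (0, v) u u) (by fun_prop)
    (fun s u => by simp; ring) (fun u hu => metricL_self_pos _ hu)
  have e : nullLink U (0, v) N = {u | u ∈ J '' torusCone ∧ metricL (0, v) u u = 1} := by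
    rw [nullLink, nullCone_eq_image hJ hB]
    simp only [lumpMetric_eq]
  rw [e]
  exact h

theorem not_isTwoThreeSpheres_nullLink (hv : v 1 = 0) (hN : IsNormalFieldAt U (0, v) N) :
    ¬ IsTwoThreeSpheres U (0, v) (nullLink U (0, v) N) := by
  rintro ⟨P, P', hP, -, hd, -, -, h⟩
  obtain ⟨J, hinj, hJ, hB⟩ := exists_torusCone_form hv hN
  -- A plane on which `B` is positive definite. Inside the five-dimensional tangent space it must
  -- meet the four-dimensional `P`, whose unit sphere lies in the null cone.
  set Q : Submodule ℝ Coord := LinearMap.range (J ∘ₗ LinearMap.inl ℝ ℂ (ℂ × ℝ)) with hQ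
  have hQd : finrank ℝ Q = 2 := by
    have hi : Function.Injective (J ∘ₗ LinearMap.inl ℝ ℂ (ℂ × ℝ)) :=
      hinj.comp (LinearMap.inl_injective (R := ℝ) (M := ℂ) (M₂ := ℂ × ℝ))
    rw [hQ, LinearMap.finrank_range_of_inj hi, Complex.finrank_real_complex]
  have hQt : Q ≤ tangentH := by
    rw [hQ, ← hJ]
    exact LinearMap.range_comp_le_range _ _
  have hsup : finrank ℝ (P ⊔ Q : Submodule ℝ Coord) ≤ 5 :=
    finrank_tangentH ▸ Submodule.finrank_mono (sup_le hP hQt)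
  have hsum := Submodule.finrank_sup_add_finrank_inf_eq P Q
  have hne : (P ⊓ Q) ≠ ⊥ := fun h0 => by
    rw [h0, finrank_bot, hd, hQd] at hsum
    omega
  obtain ⟨u, ⟨huP, ⟨a, rfl⟩⟩, hu0⟩ := Submodule.exists_mem_ne_zero_of_ne_bot hne
  set u := (J ∘ₗ LinearMap.inl ℝ ℂ (ℂ × ℝ)) a with hu
  have hpos := metricL_self_pos (0, v) hu0
  have hlink : (√(metricL (0, v) u u))⁻¹ • u ∈ nullLink U (0, v) N := by
    rw [h]
    refine Or.inl ⟨P.smul_mem _ huP, ?_⟩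
    rw [lumpMetric_eq]
    simp only [map_smul, smul_apply, smul_eq_mul]
    have := Real.mul_self_sqrt hpos.le
    field_simp
    linarith
  have hcone := smul_mem_nullCone hv hN hlink.1 (√(metricL (0, v) u u))
  rw [smul_inv_smul₀ (Real.sqrt_pos.2 hpos).ne'] at hcone
  have h2 := hB (a, 0, 0)
  have h3 : formB U (0, v) N (J (a, 0, 0)) (J (a, 0, 0)) = 0 := hcone.2
  rw [h3] at h2
  have ha : a = 0 := by simpa using h2.symm
  apply hu0
  rw [hu, ha, map_zero]

/-! ### Uniqueness of the polar decomposition -/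

theorem exists_smul_of_lump_eq {U U' : SU2} {p p' : Coord} (h : lump U p = lump U' p') :
    ∃ c : ℂ, lumpMatrix U' p' = c • lumpMatrix U p := by
  set a := Matrix.GeneralLinearGroup.mkOfDetNeZero (lumpMatrix U p) (det_lumpMatrix_ne_zero U p)
  set b := Matrix.GeneralLinearGroup.mkOfDetNeZero (lumpMatrix U' p') (det_lumpMatrix_ne_zero U' p')
  obtain ⟨c, hc⟩ := Matrix.GeneralLinearGroup.mem_center_iff_val_mem_range_scalar.1
    (QuotientGroup.eq.1 h)
  refine ⟨c, ?_⟩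
  have h3 : lumpMatrix U' p' = lumpMatrix U p * ((a⁻¹ * b : GL (Fin 2) ℂ) :
      Matrix (Fin 2) (Fin 2) ℂ) := by
    change (b : Matrix (Fin 2) (Fin 2) ℂ) = (a * (a⁻¹ * b) : GL (Fin 2) ℂ)
    rw [mul_inv_cancel_left]
  rw [h3]
  refine (congrArg (lumpMatrix U p * ·) hc.symm).trans ?_
  rw [Matrix.scalar_apply, ← Matrix.smul_one_eq_diagonal, mul_smul_comm, mul_one]

theorem eq_of_boostNormSq_eq {v w : R3} (h : ∀ z, boostNormSq v z = boostNormSq w z) : v = w := by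
  have h0 := h 0
  have h1 := h 1
  have h3 := h Complex.I
  simp [boostNormSq] at h0 h1 h3
  have h2 := h (-1)
  simp [boostNormSq] at h2
  have hd : dot v v = dot w w := by linarith
  have hl : lapse v = lapse w := by
    rw [lapse, lapse, norm_sq_eq_dot, norm_sq_eq_dot, hd]
  rw [hd, hl] at h0 h1 h3
  have hpos := lapse_pos w
  have k0 : v 0 = w 0 := mul_left_cancel₀ hpos.ne' (by linear_combination h1 / 4)
  have k1 : v 1 = w 1 := mul_left_cancel₀ hpos.ne' (by linear_combination -h3 / 4)
  have k2 : v 2 = w 2 := mul_left_cancel₀ hpos.ne' (by linear_combination -h0 / 2)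
  ext i
  fin_cases i
  exacts [k0, k1, k2]

/-- The function `|Mψ|²`, normalized by `|det M|`, equals `|Pψ|²`; it does not change when `M` is
rescaled, and it determines `λ`. -/
theorem snd_eq_of_lump_eq {U U' : SU2} {p p' : Coord} (h : lump U p = lump U' p') : p.2 = p'.2 := by
  obtain ⟨c, hc⟩ := exists_smul_of_lump_eq h
  have hd := congrArg (fun M => ‖Matrix.det M‖) hc
  simp only [Matrix.det_smul, det_lumpMatrix, norm_mul, norm_pow, Complex.norm_real,
    Fintype.card_fin, Real.norm_eq_abs, norm_sq_eq_dot] at hd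
  have e1 := dot_self_nonneg p.1
  have e2 := dot_self_nonneg p'.1
  rw [abs_of_pos (by positivity), abs_of_pos (by positivity)] at hd
  apply eq_of_boostNormSq_eq
  intro z
  have h1 := norm_sq_lumpMatrix U p z
  have h2 := norm_sq_lumpMatrix U' p' z
  rw [hc] at h2
  simp only [Matrix.smul_apply, smul_eq_mul, mul_assoc, ← mul_add, norm_mul, mul_pow] at h2
  rw [h1, hd] at h2
  have h3 : 1 + dot p'.1 p'.1 / 4 ≠ 0 := by positivity
  rw [hd] at h3
  apply mul_left_cancel₀ h3
  linarith

theorem lump_injective (U : SU2) : Function.Injective (lump U) := by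
  intro p p' h
  have h2 := snd_eq_of_lump_eq h
  obtain ⟨c, hc⟩ := exists_smul_of_lump_eq h
  rw [lumpMatrix_eq, lumpMatrix_eq, ← h2, ← smul_mul_assoc] at hc
  have hU : star (U : Matrix (Fin 2) (Fin 2) ℂ) * U = 1 :=
    Matrix.mem_unitaryGroup_iff'.1 (Matrix.mem_specialUnitaryGroup_iff.1 U.2).1
  have h3 := congrArg (fun M => star (U : Matrix (Fin 2) (Fin 2) ℂ) *
    (M * ((lapse p.2 : ℂ) • 1 - pauli p.2))) hc
  simp only [mul_assoc, boost_mul_inv, mul_one, smul_mul_assoc, mul_smul_comm] at h3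
  simp only [← mul_assoc, hU, one_mul] at h3
  have e00 := congrFun (congrFun h3 0) 0
  have e01 := congrFun (congrFun h3 0) 1
  have e10 := congrFun (congrFun h3 1) 0
  have e11 := congrFun (congrFun h3 1) 1
  simp [cayley, pauli] at e00 e01 e10 e11
  -- Both Cayley factors have trace 2, which fixes the scalar.
  obtain rfl : c = 1 := by linear_combination -(1 / 2) * e00 - (1 / 2) * e11
  simp [Complex.ext_iff] at e00 e01 e10 e11
  refine Prod.ext (PiLp.ext fun i => ?_) h2
  fin_cases i <;> simp <;> linarith

/-! ### Geodesics -/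

theorem snd_apply_one_eq_zero_of_mem {U : SU2} {p : Coord} (h : lump U p ∈ hypersurfaceH) :
    p.2 1 = 0 := by
  obtain ⟨U', v, hv, h⟩ := h
  rw [snd_eq_of_lump_eq h]
  exact hv

theorem eq_zero_of_hasDerivAt {f : ℝ → ℝ} {a t : ℝ} (hf : HasDerivAt f a t)
    (h : ∀ᶠ s in 𝓝[≥] t, f s = 0) : a = 0 := by
  have h1 : HasDerivWithinAt (fun _ => (0 : ℝ)) a (Ici t) t :=
    hf.hasDerivWithinAt.congr_of_eventuallyEq (h.mono fun s hs => hs.symm)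
      (h.self_of_nhdsWithin self_mem_Ici).symm
  exact (uniqueDiffWithinAt_Ici t).eq_deriv _ h1 (hasDerivWithinAt_const t (Ici t) 0)

/-- If a curve of class `C²` stays in the kernel of `ℓ` for small nonnegative times, then so does
its second derivative at time zero. -/
theorem apply_deriv_deriv_eq_zero {E : Type*} [NormedAddCommGroup E] [NormedSpace ℝ E]
    (ℓ : E →L[ℝ] ℝ) {c : ℝ → E} (hc : ContDiffAt ℝ 2 c 0) (h : ∀ᶠ t in 𝓝[≥] 0, ℓ (c t) = 0) :
    ℓ (deriv (deriv c) 0) = 0 := by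
  have hd : DifferentiableAt ℝ (deriv c) 0 :=
    ((hc.fderiv_right (m := 1) (by norm_num)).clm_apply contDiffAt_const).differentiableAt
      one_ne_zero
  have h1 : ∀ᶠ t in 𝓝 (0 : ℝ), DifferentiableAt ℝ c t :=
    (hc.eventually (by simp)).mono fun t ht => ht.differentiableAt two_ne_zero
  -- One-sided vanishing is used twice: first at each `t` in a short interval to the right of zero,
  -- for the velocity, then at zero for the acceleration.
  refine eq_zero_of_hasDerivAt (ℓ.hasFDerivAt.comp_hasDerivAt 0 hd.hasDerivAt) ?_
  obtain ⟨δ, hδ, hs⟩ := mem_nhdsGE_iff_exists_Ico_subset.1 h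
  filter_upwards [Ico_mem_nhdsGE hδ, h1.filter_mono nhdsWithin_le_nhds] with t ht hct
  refine eq_zero_of_hasDerivAt (ℓ.hasFDerivAt.comp_hasDerivAt t hct.hasDerivAt) ?_
  filter_upwards [Ico_mem_nhdsGE ht.2] with s hst using hs ⟨ht.1.trans hst.1, hst.2⟩

theorem mem_nullCone_of_geodesic {U : SU2} {v : R3} {N : Coord → Coord} (hv : v 1 = 0)
    (hN : IsNormalFieldAt U (0, v) N) {u : Coord} (hu : u ∈ tangentH) {x : ℝ → LumpSpace} {ε : ℝ}
    (hε : 0 < ε) (hx : IsLumpGeodesicOn x (Ioo (-ε) ε)) (hxu : HasLumpVelocityAt U (0, v) u x 0)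
    (hH : ∀ t ∈ Ico 0 ε, x t ∈ hypersurfaceH) : u ∈ nullCone U (0, v) N := by
  refine ⟨hu, ?_⟩
  obtain ⟨b, hb0, hbu, hb⟩ := hxu
  obtain ⟨c, hc2, hc, hgeo⟩ := hx 0 ⟨by linarith, hε⟩ U ⟨(0, v), by rw [hb.self_of_nhds, hb0]⟩
  -- The curve that carries the velocity and the curve that solves the geodesic equation agree near
  -- zero, because the chart is injective.
  have hbc : b =ᶠ[𝓝 0] c := by
    filter_upwards [hb, hc] with t h1 h2 using lump_injective U (h1.symm.trans h2)
  have hc0 : c 0 = (0, v) := hbc.self_of_nhds ▸ hb0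
  have hcu : deriv c 0 = u := (hbu.congr_of_eventuallyEq hbc.symm).deriv
  set ℓ : Coord →L[ℝ] ℝ := (EuclideanSpace.proj (1 : Fin 3)).comp (ContinuousLinearMap.snd ℝ R3 R3)
  have hℓ : ∀ᶠ t in 𝓝[≥] (0 : ℝ), ℓ (c t) = 0 := by
    filter_upwards [Ico_mem_nhdsGE hε, hc.filter_mono nhdsWithin_le_nhds] with t ht h
    exact snd_apply_one_eq_zero_of_mem (h ▸ hH t ht)
  have hacc : deriv (deriv c) 0 ∈ tangentH := apply_deriv_deriv_eq_zero ℓ hc2 hℓ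
  -- Paired with `N`, the tangential acceleration drops out, and the Christoffel term that remains
  -- is `-B(u, u)`.
  have h := hgeo (N (0, v))
  rw [hc0, hcu, christoffel_eq_neg_secondForm, lumpMetric_eq, metricL_comm, ← lumpMetric_eq U,
    (hN.2.self_of_nhds hv).2 _ hacc] at h
  rw [formB_eq_secondForm hv hN hu hu]
  linarith

end

theorem theorem2p1 :
    finrank ℝ tangentH = 5 ∧
    ∃ L : Set hypersurfaceH, IsNowhereDense L ∧
      ∀ (U : SU2) (lam : R3) (hlam : lam 1 = 0),
        (∃ N : Coord → Coord, IsNormalFieldAt U (0, lam) N) ∧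
        ∀ N : Coord → Coord, IsNormalFieldAt U (0, lam) N →
          -- `B` is symmetric
          (∀ u ∈ tangentH, ∀ v ∈ tangentH,
            formB U (0, lam) N u v = formB U (0, lam) N v u) ∧
          -- velocities of geodesics that remain in `H` lie in the null cone of `B`
          (∀ u ∈ tangentH, ∀ (x : ℝ → LumpSpace) (ε : ℝ), 0 < ε →
            IsLumpGeodesicOn x (Ioo (-ε) ε) → HasLumpVelocityAt U (0, lam) u x 0 →
            (∀ t ∈ Ico 0 ε, x t ∈ hypersurfaceH) → u ∈ nullCone U (0, lam) N) ∧
          -- the null cone is a closed cone of codimension one in the five-dimensional space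
          (∀ u ∈ nullCone U (0, lam) N, ∀ r : ℝ, 0 ≤ r → r • u ∈ nullCone U (0, lam) N) ∧
          IsClosed (nullCone U (0, lam) N) ∧
          dimH (nullCone U (0, lam) N) = 4 ∧
          -- the link at generic points
          ((⟨lump U (0, lam), U, lam, hlam, rfl⟩ : hypersurfaceH) ∉ L →
            Nonempty (nullLink U (0, lam) N ≃ₜ TopSuspension (Circle × Circle))) ∧
          -- the link at exceptional points
          ((⟨lump U (0, lam), U, lam, hlam, rfl⟩ : hypersurfaceH) ∈ L ↔
            IsTwoThreeSpheres U (0, lam) (nullLink U (0, lam) N)) ∧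
          -- in standard position, the exceptional points are those with `f₂ = 0`
          (∀ r : ℝ, 0 ≤ r → lam = EuclideanSpace.single 2 r →
            ((⟨lump U (0, lam), U, lam, hlam, rfl⟩ : hypersurfaceH) ∈ L ↔
              coeffF2 U (0, lam) N = 0)) := by
  -- The exceptional set is taken empty: `B` has the same normal form at every point of `H`, so both
  -- characterizations of `L` are equivalences between false statements.
  refine ⟨finrank_tangentH, ∅, isNowhereDense_empty, fun U lam hlam =>
    ⟨⟨normalField, isNormalFieldAt_normalField U _⟩, fun N hN => ⟨fun u hu v hv => ?_,
      fun u hu x ε hε hx hxu hH => mem_nullCone_of_geodesic hlam hN hu hε hx hxu hH,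
      fun u hu r _ => smul_mem_nullCone hlam hN hu r, isClosed_nullCone hlam hN,
      dimH_nullCone hlam hN, fun _ => nonempty_nullLink_homeomorph hlam hN,
      iff_of_false (notMem_empty _) (not_isTwoThreeSpheres_nullLink hlam hN),
      fun r hr h => iff_of_false (notMem_empty _) ?_⟩⟩⟩
  · rw [formB_eq_secondForm hlam hN hu hv, formB_eq_secondForm hlam hN hv hu, secondForm_comm]
  · subst h
    exact coeffF2_ne_zero hr hN
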